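/- Conventions. All graphs are simple (unoriented, without loops). For a subset $S$ of a group $H$, the Cayley graph $\mathrm{Cay}(H,S)$ has vertex set $H$, and an edge between $g$ and $gx$ for all $g\in H$, $x\in S$ with $gx\ne g$. For a finite graph $\Gamma$ with vertex set $V\Gamma$, let $$h(\Gamma)=\inf\left\{\frac{|\partial X|}{|X|} : \emptyset\ne X\subset V\Gamma,\ |X|\le \tfrac12|V\Gamma|\right\},$$ where $\partial X$ is the set of vertices outside $X$ adjacent to a vertex of $X$. For $p\in[1,\infty)$ and a finite graph $\Gamma$ with at least two vertices, let $$h_p(\Gamma)=\inf\left\{\frac{\|\nabla f\|_p}{\|f-f_\Gamma\|_p} : f\colon V\Gamma\to\mathbf R,\ \|f-f_\Gamma\|_p\neq0\right\},$$ where $|\nabla f|(g)=\sup_{u,u'\in B(g,1)}|f(u)-f(u')|$, $B(g,1)$ consists of $g$ and its neighbours, $f_\Gamma=|V\Gamma|^{-1}\sum_{g\in V\Gamma} f(g)$, and $\|\varphi\|_p=(\sum_{g\in V\Gamma}|\varphi(g)|^p)^{1/p}$. The $L^p$-Poincaré profile of a graph $G$ is $$\Pi_{G,p}(n)=\sup\{|V\Gamma|\,h_p(\Gamma)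 : \Gamma \text{ a subgraph of } G,\ 2\le|V\Gamma|\le n\}.$$ Lamplighter diagonal products. Let $A$, $B$ be non-trivial finite groups, and let $(\Gamma_s)_{s\ge0}$ be groups with injective homomorphisms $a_s\colon A\to\Gamma_s$, $b_s\colon B\to\Gamma_s$, whose images $A_s$, $B_s$ together generate $\Gamma_s$ and are such that the quotient of $\Gamma_s$ by the normal closure of $[A_s,B_s]$ is isomorphic to $A_s\times B_s$, for every $s\ge 0$. Let $(k_s)_{s\ge0}$ be non-negative integers with $k_0=0$ and $k_{s+1}>2k_s$ for every $s\ge0$. Let $\Gamma_s\wr\mathbf Z$ be the group of pairs $(f,i)$, with $f\colon\mathbf Z\to\Gamma_s$ finitely supported and $i\in\mathbf Z$, and with product $(f,i)(g,j)=(h,i+j)$, where $h_x=f_xg_{x-i}$. Let $\mathbf G=A*B*\mathbf Z$ be the free product, $\tau$ a generator of the copy of $\mathbf Z$, and $\pi_s\colon\mathbf G\to\Gamma_s\wr\mathbf Z$ the homomorphism that sends $x\in A$ to $(a_s(x)\delta_{-k_s},0)$, $y\in B$ to $(b_s(y)\delta_{k_s},0)$, and $\tau$ to $(1,1)$; here $g\delta_i$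 is the function equal to $g$ at $i$ and trivial elsewhere. The lamplighter diagonal product of $(\Gamma_s,a_s,b_s,k_s)_{s\ge0}$ is $\Delta=\mathbf G/\bigcap_{s\ge0}\ker\pi_s$. It is viewed as a graph through its Cayley graph with respect to the images of $A$, $B$ and $\tau^{\pm1}$, and $\Gamma_s$ is viewed as the regular graph $\mathrm{Cay}(\Gamma_s,A_s\cup B_s)$, of degree $\deg\Gamma_s$. Theorem. Let $\Delta$ be the lamplighter diagonal product of $(\Gamma_s,a_s,b_s,k_s)_{s\ge0}$, and let $p\in[1,\infty)$. Then for every $s\ge0$ such that $\Gamma_s$ is finite and every integer $r$ with $0\le r\le k_s/2$, $$\Pi_{\Delta,p}\big((2k_s+2r+1)|\Gamma_s|^{2r+1}\big)\ \ge\ 4^{-p}\,\frac{h(\Gamma_s)^2}{1536\,(\deg\Gamma_s)^2}\,\frac{|\Gamma_s|^{2r+1}}{2r+1}.$$ -/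

import Mathlib

noncomputable section

/-! ### Cheeger constants and Poincaré profiles of graphs -/

/-- The outer vertex boundary `∂A`: vertices outside `A` that are adjacent to a vertex of `A`. -/
def outerBoundary {V : Type*} (G : SimpleGraph V) (A : Set V) : Set V :=
  {v | v ∉ A ∧ ∃ u ∈ A, G.Adj u v}

/-- The combinatorial Cheeger constant `h(G)` of a finite graph: the infimum of `|∂A| / |A|` over
the non-empty sets `A` of at most half of the vertices. -/
def cheegerConst {V : Type*} [Finite V] (G : SimpleGraph V) : ℝ :=
  sInf {x : ℝ | ∃ A : Set V, A.Nonempty ∧ 2 * A.ncard ≤ Nat.card V ∧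
    x = ((outerBoundary G A).ncard : ℝ) / (A.ncard : ℝ)}

/-- The closed ball `B(g, 1)` in the shortest path metric: `g` and its neighbours. -/
def unitBall {V : Type*} (G : SimpleGraph V) (g : V) : Set V :=
  {v | v = g ∨ G.Adj g v}

/-- The gradient at scale one: `|∇f|(g)` is the supremum of `|f h - f h'|` over
`h, h' ∈ B(g, 1)`. -/
def gradAbs {V : Type*} (G : SimpleGraph V) (f : V → ℝ) (g : V) : ℝ :=
  sSup {x : ℝ | ∃ h ∈ unitBall G g, ∃ h' ∈ unitBall G g, x = |f h - f h'|}

/-- The `ℓ^p` norm of a real function on a finite set, `1 ≤ p < ∞`. -/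
def ellNorm {V : Type*} [Fintype V] (p : ℝ) (f : V → ℝ) : ℝ :=
  (∑ v, |f v| ^ p) ^ (1 / p)

/-- The average of a real function on a finite set. -/
def avg {V : Type*} [Fintype V] (f : V → ℝ) : ℝ :=
  (∑ v, f v) / (Fintype.card V : ℝ)

/-- The `L^p`-Cheeger constant of a finite graph (with at least two vertices). -/
def lpCheegerConst {V : Type*} [Fintype V] (G : SimpleGraph V) (p : ℝ) : ℝ :=
  sInf {x : ℝ | ∃ f : V → ℝ, ellNorm p (fun v => f v - avg f) ≠ 0 ∧
    x = ellNorm p (gradAbs G f) / ellNorm p (fun v => f v - avg f)}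

/-- The `L^p`-Poincaré profile of a graph: the supremum of `|Γ| h_p(Γ)` over the finite subgraphs
`Γ` with at most `n` vertices (and at least two, so that `h_p(Γ)` is an infimum over a non-empty
set). -/
def poincareProfile {V : Type*} (G : SimpleGraph V) (p : ℝ) (n : ℕ) : ℝ :=
  sSup {x : ℝ | ∃ (H : G.Subgraph) (_ : Fintype H.verts), 2 ≤ Fintype.card H.verts ∧
    Fintype.card H.verts ≤ n ∧ x = (Fintype.card H.verts : ℝ) * lpCheegerConst H.coe p}

/-! ### Wreath products with `ℤ` -/

/-- The wreath product `Γ ≀ ℤ`: a finitely supported lamp configuration together with the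
position of the cursor. -/
@[ext]
structure Lamplighter (Γ : Type*) [Group Γ] where
  lamp : ℤ → Γ
  cursor : ℤ
  finite_support : (Function.mulSupport lamp).Finite

namespace Lamplighter

variable {Γ : Type*} [Group Γ]

instance : Mul (Lamplighter Γ) where
  mul x y :=
    { lamp := fun n => x.lamp n * y.lamp (n - x.cursor)
      cursor := x.cursor + y.cursor
      finite_support := by
        refine (x.finite_support.union
          (y.finite_support.image (fun n => n + x.cursor))).subset ?_
        intro n hn
        by_contra hcon
        simp only [Set.mem_union, Function.mem_mulSupport, Set.mem_image, not_or, not_not,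
          not_exists, not_and] at hcon
        refine hn ?_
        have h2 : y.lamp (n - x.cursor) = 1 := by
          by_contra hy
          exact hcon.2 (n - x.cursor) hy (by ring)
        simp [hcon.1, h2] }

instance : One (Lamplighter Γ) where
  one := { lamp := fun _ => 1, cursor := 0, finite_support := by simp [Function.mulSupport] }

instance : Inv (Lamplighter Γ) where
  inv x :=
    { lamp := fun n => (x.lamp (n + x.cursor))⁻¹
      cursor := -x.cursor
      finite_support := by
        refine (x.finite_support.image (fun n => n - x.cursor)).subset ?_
        intro n hn
        refine ⟨n + x.cursor, ?_, by ring⟩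
        intro h
        exact hn (by simp [h]) }

@[simp] lemma mul_lamp (x y : Lamplighter Γ) (n : ℤ) :
    (x * y).lamp n = x.lamp n * y.lamp (n - x.cursor) := rfl

@[simp] lemma mul_cursor (x y : Lamplighter Γ) : (x * y).cursor = x.cursor + y.cursor := rfl

@[simp] lemma one_lamp (n : ℤ) : (1 : Lamplighter Γ).lamp n = 1 := rfl

@[simp] lemma one_cursor : (1 : Lamplighter Γ).cursor = 0 := rfl

@[simp] lemma inv_lamp (x : Lamplighter Γ) (n : ℤ) :
    (x⁻¹).lamp n = (x.lamp (n + x.cursor))⁻¹ := rfl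

@[simp] lemma inv_cursor (x : Lamplighter Γ) : (x⁻¹).cursor = -x.cursor := rfl

instance : Group (Lamplighter Γ) :=
  Group.ofLeftAxioms
    (fun x y z => by
      ext n
      · simp [mul_assoc, sub_sub]
      · simp [add_assoc])
    (fun x => by
      ext n <;> simp)
    (fun x => by
      ext n <;> simp)

/-- The element `(g δ_i, 0)`, with `g δ_i` the lamp configuration equal to `g` at `i` and to `1`
elsewhere. -/
def dirac (i : ℤ) : Γ →* Lamplighter Γ where
  toFun g :=
    { lamp := fun n => if n = i then g else 1
      cursor := 0
      finite_support := by
        refine (Set.finite_singleton i).subset ?_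
        intro n hn
        by_contra h
        exact hn (if_neg h) }
  map_one' := by
    ext n
    · show (if n = i then (1 : Γ) else 1) = 1
      simp
    · rfl
  map_mul' g g' := by
    ext n
    · show (if n = i then g * g' else 1)
        = (if n = i then g else 1) * (if n - 0 = i then g' else 1)
      by_cases h : n = i <;> simp [h]
    · rfl

/-- The element `(1, 1)`: no lamp is changed and the cursor moves by one. -/
def shift : Lamplighter Γ where
  lamp := fun _ => 1
  cursor := 1
  finite_support := by simp [Function.mulSupport]

end Lamplighter

/-! ### Lamplighter diagonal products -/

/-- The free product `A * B * ℤ`. -/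
abbrev FreeLampGroup (A B : Type*) [Group A] [Group B] : Type _ :=
  Monoid.Coprod A (Monoid.Coprod B (Multiplicative ℤ))

namespace FreeLampGroup

variable (A B : Type*) [Group A] [Group B]

/-- The inclusion of `A` in the free product. -/
def inA : A →* FreeLampGroup A B := Monoid.Coprod.inl

/-- The inclusion of `B` in the free product. -/
def inB : B →* FreeLampGroup A B := Monoid.Coprod.inr.comp Monoid.Coprod.inl

/-- The generator of the copy of `ℤ` in the free product. -/
def tau : FreeLampGroup A B :=
  Monoid.Coprod.inr (Monoid.Coprod.inr (Multiplicative.ofAdd (1 : ℤ)))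

end FreeLampGroup

/-- The homomorphism from `A * B * ℤ` to `Γ ≀ ℤ` that sends `x ∈ A` to `(a(x) δ_{-k}, 0)`,
`y ∈ B` to `(b(y) δ_k, 0)`, and the generator of `ℤ` to `(1, 1)`. -/
def lampHom {A B Γ : Type*} [Group A] [Group B] [Group Γ] (a : A →* Γ) (b : B →* Γ) (k : ℕ) :
    FreeLampGroup A B →* Lamplighter Γ :=
  Monoid.Coprod.lift ((Lamplighter.dirac (-(k : ℤ))).comp a)
    (Monoid.Coprod.lift ((Lamplighter.dirac (k : ℤ)).comp b)
      (zpowersHom (Lamplighter Γ) Lamplighter.shift))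

section DiagonalProduct

variable {A B : Type*} [Group A] [Group B] {Γ : ℕ → Type*} [∀ s, Group (Γ s)]
  (a : ∀ s, A →* Γ s) (b : ∀ s, B →* Γ s) (k : ℕ → ℕ)

/-- The intersection of the kernels of the homomorphisms `A * B * ℤ → Γ_s ≀ ℤ`. -/
def lampKernel : Subgroup (FreeLampGroup A B) :=
  ⨅ s, (lampHom (a s) (b s) (k s)).ker

instance lampKernel_normal : (lampKernel a b k).Normal :=
  Subgroup.normal_iInf_normal fun _ => inferInstance

/-- The lamplighter diagonal product `Δ` of `(Γ_s, a_s, b_s, k_s)`. -/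
abbrev LampDiagonalProduct : Type _ := FreeLampGroup A B ⧸ lampKernel a b k

/-- The generating set of `Δ`: the images of `A`, of `B`, and of the generator of `ℤ` and its
inverse. -/
def lampGenerators : Set (LampDiagonalProduct a b k) :=
  QuotientGroup.mk' (lampKernel a b k) ''
    (Set.range (FreeLampGroup.inA A B) ∪ Set.range (FreeLampGroup.inB A B) ∪
      {FreeLampGroup.tau A B, (FreeLampGroup.tau A B)⁻¹})

/-- The Cayley graph of `Δ`. -/
def lampDiagonalGraph : SimpleGraph (LampDiagonalProduct a b k) :=
  SimpleGraph.mulCayley (lampGenerators a b k)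

end DiagonalProduct

/-- The Cayley graph of a group with respect to the union of the images of two homomorphisms. -/
def factorCayleyGraph {A B Γ : Type*} [Group A] [Group B] [Group Γ] (a : A →* Γ) (b : B →* Γ) :
    SimpleGraph Γ :=
  SimpleGraph.mulCayley (Set.range a ∪ Set.range b)

/-- The degree of this (regular) graph, measured at the vertex `1`. -/
def factorCayleyDegree {A B Γ : Type*} [Group A] [Group B] [Group Γ] (a : A →* Γ)
    (b : B →* Γ) : ℕ :=
  ((factorCayleyGraph a b).neighborSet 1).ncard

/-- All vertices have the same number of neighbours. -/
lemma factorCayleyDegree_eq {A B Γ : Type*} [Group A] [Group B] [Group Γ] (a : A →* Γ)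
    (b : B →* Γ) (g : Γ) :
    ((factorCayleyGraph a b).neighborSet g).ncard = factorCayleyDegree a b := by
  have h : (factorCayleyGraph a b).neighborSet g =
      (fun x => g * x) '' (factorCayleyGraph a b).neighborSet 1 := by
    ext x
    simp only [SimpleGraph.mem_neighborSet, factorCayleyGraph, SimpleGraph.mulCayley_adj',
      Set.mem_image]
    constructor
    · rintro ⟨hne, s, hs, h⟩
      refine ⟨g⁻¹ * x, ⟨?_, s, hs, ?_⟩, by group⟩
      · intro h1
        exact hne (by rw [eq_inv_mul_iff_mul_eq, mul_one] at h1; exact h1)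
      · rcases h with h | h
        · left; rw [← h]; group
        · right; rw [h]; group
    · rintro ⟨y, ⟨hne, s, hs, h⟩, rfl⟩
      refine ⟨?_, s, hs, ?_⟩
      · intro h1
        exact hne (by simpa [eq_comm] using h1)
      · rcases h with h | h
        · left; rw [← h]; group
        · right; rw [mul_assoc, ← h, mul_one]
  rw [h, Set.ncard_image_of_injective _ (mul_right_injective g)]
  rfl

end

/-!
The lower bound is witnessed by one finite induced subgraph of `Δ`. Its vertices are the pairs of a
`Γ_s`-valued lamp configuration in the window `[-r, r]` and a cursor position in
`[-(k_s + r), k_s + r]`: this segment is exactly what is needed for the lamp at each `x` to be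
changed by `A`, with the cursor at `x + k_s`, and by `B`, with the cursor at `x - k_s`.

Such pairs live in `Γ_s ≀ ℤ`, and they lift to `Δ` (`exists_lift_lampWindow`,
`exists_lampCursor_embedding`). When a configuration is written by these moves, the lamps of another
`Γ_t` are changed by `A` at positions in `[-r, r] - d` and by `B` at positions in `[-r, r] + d`,
where `d = k_t - k_s`. The growth of `k` and `2 r ≤ k_s` give `|d| > r`, so that these two sets of
positions are disjoint, and the configuration in `Γ_t` depends only on the images of the `Γ_s`-lamps
under the projections `Γ_s → A` and `Γ_s → B` (`LampWindow.exists_hom_other`), which exist by the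
hypothesis on the quotient by the normal closure of `[A_s, B_s]` (`exists_factor_projections`).

It remains to prove an `ℓ^p`-Poincaré inequality on this subgraph. With `d` now the degree and `h`
the Cheeger constant of `Γ_s`, the co-area inequality applied to `p`-th powers gives such an
inequality on `Γ_s` with a constant of order `p d / h` (`Isoperimetric.poincare`). Since
`ψ ↦ ‖f(· ψ) - f‖_p` is a length function on the group of configurations, the inequality passes to
the power with a factor `2 r + 1` (`Isoperimetric.sum_translationEnergy_le`). A lamp is changed at
an arbitrary cursor position by a detour through the position where the change is allowed, which costs
a factor of the order of the length of the segment (`Isoperimetric.lampCursor_poincare`). The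
resulting constant `48 p d (2 r + 1) (2 k_s + 2 r + 1) / h` is better than the one claimed, because
`p ≤ 4 ^ p` and `h ≤ d`.
-/

/-! ### Poincaré inequalities on a finite group from isoperimetry -/

/-- Convexity of `t ↦ t ^ p`: the graph lies above its tangent at `m`. -/
lemma tangent_le_rpow {p : ℝ} (hp : 1 ≤ p) {x m : ℝ} (hx : 0 ≤ x) (hm : 0 ≤ m) :
    m ^ p + p * m ^ (p - 1) * (x - m) ≤ x ^ p := by
  rcases hm.eq_or_lt with rfl | hm
  · rcases hp.eq_or_lt with rfl | hp1
    · simp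
    · rw [Real.zero_rpow (by linarith), Real.zero_rpow (by linarith)]
      simpa using Real.rpow_nonneg hx p
  · have h := one_add_mul_self_le_rpow_one_add (s := x / m - 1) (p := p)
      (by have := div_nonneg hx hm.le; linarith) hp
    rw [add_sub_cancel, Real.div_rpow hx hm.le, le_div_iff₀ (Real.rpow_pos_of_pos hm p)] at h
    have e : m ^ p = m * m ^ (p - 1) := by
      rw [mul_comm, ← Real.rpow_add_one hm.ne']; simp
    refine le_trans (le_of_eq ?_) h
    rw [e]; field_simp

/-- The variation of `t ↦ t ^ p`, with a free parameter `l` that weights the increment against the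
values. -/
lemma abs_rpow_sub_rpow_le {p : ℝ} (hp : 1 ≤ p) {x y l : ℝ} (hx : 0 ≤ x) (hy : 0 ≤ y)
    (hl : 0 < l) :
    |x ^ p - y ^ p| ≤ l⁻¹ * (l ^ p * |x - y| ^ p + (p - 1) * (x ^ p + y ^ p)) := by
  wlog hxy : y ≤ x generalizing x y
  · have := this hy hx (le_of_not_ge hxy)
    rwa [abs_sub_comm, abs_sub_comm x, add_comm (x ^ p)]
  have h0 : y ^ p ≤ x ^ p := Real.rpow_le_rpow hy hxy (by linarith)
  have hd : 0 ≤ x - y := sub_nonneg.2 hxy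
  rw [abs_of_nonneg (sub_nonneg.2 h0), abs_of_nonneg hd]
  have h1 := tangent_le_rpow hp hy hx
  -- Young's inequality for the product of `l * (x - y)` and `x ^ (p - 1)`
  have h2 := tangent_le_rpow hp (mul_nonneg hl.le hd) hx
  rw [Real.mul_rpow hl.le hd] at h2
  have e : x ^ p = x ^ (p - 1) * x := by
    rcases hx.eq_or_lt with rfl | hx
    · rw [Real.zero_rpow (by linarith)]; simp
    · rw [← Real.rpow_add_one hx.ne']; simp
  have h3 : 0 ≤ (p - 1) * y ^ p := mul_nonneg (by linarith) (Real.rpow_nonneg hy p)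
  have h4 : l * (x ^ p - y ^ p) ≤ l ^ p * (x - y) ^ p + (p - 1) * (x ^ p + y ^ p) := by
    have h5 : l * (x ^ p - y ^ p) ≤ l * (p * x ^ (p - 1) * (x - y)) :=
      mul_le_mul_of_nonneg_left (by linarith) hl.le
    have h6 : p * x ^ (p - 1) * (l * (x - y) - x) =
      l * (p * x ^ (p - 1) * (x - y)) - p * x ^ p := by rw [e]; ring
    linarith
  rw [inv_mul_eq_div, le_div_iff₀ hl]
  linarith

lemma abs_add_rpow_le {p : ℝ} (hp : 1 ≤ p) (x y : ℝ) :
    |x + y| ^ p ≤ 2 ^ (p - 1) * (|x| ^ p + |y| ^ p) := by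
  have h := Real.rpow_sum_le_const_mul_sum_rpow Finset.univ ![x, y] hp
  simp [Fin.sum_univ_two] at h
  exact (Real.rpow_le_rpow (abs_nonneg _) (abs_add_le x y) (by linarith)).trans h

lemma abs_add_three_rpow_le {p : ℝ} (hp : 1 ≤ p) (x y z : ℝ) :
    |x + y + z| ^ p ≤ 3 ^ (p - 1) * (|x| ^ p + |y| ^ p + |z| ^ p) := by
  have h := Real.rpow_sum_le_const_mul_sum_rpow Finset.univ ![x, y, z] hp
  simp [Fin.sum_univ_three] at h
  exact (Real.rpow_le_rpow (abs_nonneg _) (abs_add_three x y z) (by linarith)).trans h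

section Isoperimetry

variable {Γ : Type*} [Group Γ] [Fintype Γ]

open scoped Classical in
/-- The edge isoperimetric inequality with constant `h` for right multiplication by the elements
of `S`; the edges leaving `X` are counted by the variation of its indicator function, hence in
both directions. -/
def Isoperimetric (S : Finset Γ) (h : ℝ) : Prop :=
  ∀ X : Finset Γ, X.Nonempty → 2 * X.card ≤ Fintype.card Γ →
    h * X.card ≤ ∑ u, ∑ s ∈ S, |(if u * s ∈ X then (1 : ℝ) else 0) - (if u ∈ X then 1 else 0)|

/-- Co-area inequality. The proof peels off the level sets of `G`, from the smallest positive value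
upwards. -/
lemma Isoperimetric.sum_le {S : Finset Γ} {h : ℝ} (hS : Isoperimetric S h)
    (G : Γ → ℝ) (hG : ∀ u, 0 ≤ G u)
    (hsupp : 2 * (Finset.univ.filter fun u => 0 < G u).card ≤ Fintype.card Γ) :
    h * ∑ u, G u ≤ ∑ u, ∑ s ∈ S, |G (u * s) - G u| := by
  classical
  induction hn : (Finset.univ.filter fun u => 0 < G u).card using Nat.strong_induction_on
    generalizing G with
  | _ n ih =>
    subst hn
    set X := Finset.univ.filter fun u => 0 < G u with hX
    have hmem : ∀ u, u ∈ X ↔ 0 < G u := by simp [hX]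
    have hnot : ∀ u, u ∉ X → G u = 0 := fun u hu =>
      le_antisymm (not_lt.1 fun h => hu ((hmem u).2 h)) (hG u)
    rcases X.eq_empty_or_nonempty with hE | hne
    · have h0 : ∀ u, G u = 0 := fun u => hnot u (by simp [hE])
      simp [h0]
    obtain ⟨u₀, hu₀, hmin⟩ := X.exists_min_image G hne
    have hm : 0 < G u₀ := (hmem u₀).1 hu₀
    set G' : Γ → ℝ := fun u => G u - G u₀ * (if u ∈ X then 1 else 0) with hG'
    have hG'0 : ∀ u, 0 ≤ G' u := by
      intro u
      by_cases hu : u ∈ X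
      · simpa [hG', hu] using hmin u hu
      · simpa [hG', hu] using hG u
    have hsub : (Finset.univ.filter fun u => 0 < G' u) ⊂ X := by
      refine (Finset.ssubset_iff_of_subset ?_).2 ⟨u₀, hu₀, by simp [hG', hu₀]⟩
      intro u hu
      by_contra hu'
      simp [hG', hu', hnot u hu'] at hu
    have hcard := Finset.card_lt_card hsub
    have h1 := ih _ hcard G' hG'0 (by omega) rfl
    have h2 := hS X hne hsupp
    have h3 : ∑ u, G u = ∑ u, G' u + G u₀ * X.card := by
      simp [hG', Finset.sum_sub_distrib, mul_comm]
    have h4 : ∀ u s, |G (u * s) - G u| = |G' (u * s) - G' u| +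
        G u₀ * |(if u * s ∈ X then (1 : ℝ) else 0) - (if u ∈ X then 1 else 0)| := by
      intro u s
      by_cases hu : u ∈ X <;> by_cases hus : u * s ∈ X
      · simp [hG', hu, hus]
      · have := hmin u hu
        simp only [hG', hu, hus, hnot _ hus, if_true, if_false]
        rw [abs_of_nonpos (by linarith), abs_of_nonpos (by linarith)]
        norm_num
      · have := hmin _ hus
        simp only [hG', hu, hus, hnot _ hu, if_true, if_false]
        rw [abs_of_nonneg (by linarith), abs_of_nonneg (by linarith)]
        norm_num
      · simp [hG', hu, hus]
    simp only [h4, Finset.sum_add_distrib, ← Finset.mul_sum]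
    rw [h3]
    nlinarith [mul_le_mul_of_nonneg_left h2 hm.le]

/-- A function whose support fills at most half of the group satisfies an `ℓ^p`-Sobolev inequality
without subtracting its mean. -/
lemma Isoperimetric.sum_rpow_le {S : Finset Γ} {h : ℝ} (hS : Isoperimetric S h) (hh : 0 < h)
    (hd : S.Nonempty) {p : ℝ} (hp : 1 ≤ p) (G : Γ → ℝ) (hG : ∀ u, 0 ≤ G u)
    (hsupp : 2 * (Finset.univ.filter fun u => 0 < G u).card ≤ Fintype.card Γ) :
    ∑ u, G u ^ p ≤ 2 / h * (4 * p * S.card / h) ^ (p - 1) *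
      ∑ u, ∑ s ∈ S, |G (u * s) - G u| ^ p := by
  have hp0 : 0 < p := by linarith
  have hd' : (0 : ℝ) < S.card := by exact_mod_cast hd.card_pos
  -- `l` is large enough for the terms without a difference to be absorbed by half of the left side
  set l : ℝ := 4 * p * S.card / h with hl
  have hl0 : 0 < l := by positivity
  have h1 := hS.sum_le (fun u => G u ^ p) (fun u => Real.rpow_nonneg (hG u) p) (by
    rwa [Finset.filter_congr fun u _ =>
      ⟨fun hu => (hG u).lt_of_ne fun e => by simp [← e, hp0.ne'] at hu,
        fun hu => Real.rpow_pos_of_pos hu p⟩])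
  have h2 : ∑ u, ∑ s ∈ S, |G (u * s) ^ p - G u ^ p| ≤
      ∑ u, ∑ s ∈ S, l⁻¹ * (l ^ p * |G (u * s) - G u| ^ p + (p - 1) * (G (u * s) ^ p + G u ^ p)) :=
    Finset.sum_le_sum fun u _ => Finset.sum_le_sum fun s _ =>
      abs_rpow_sub_rpow_le hp (hG _) (hG _) hl0
  have h3 : ∑ u, ∑ s ∈ S, G (u * s) ^ p = S.card * ∑ u, G u ^ p := by
    rw [Finset.sum_comm]
    have : ∀ s ∈ S, ∑ u, G (u * s) ^ p = ∑ u, G u ^ p := fun s _ =>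
      Equiv.sum_comp (Equiv.mulRight s) fun u => G u ^ p
    rw [Finset.sum_congr rfl this]; simp
  simp only [← Finset.mul_sum, Finset.sum_add_distrib, h3, Finset.sum_const, nsmul_eq_mul] at h2
  set Z := ∑ u, G u ^ p
  set E := ∑ u, ∑ s ∈ S, |G (u * s) - G u| ^ p
  have hZ : 0 ≤ Z := Finset.sum_nonneg fun u _ => Real.rpow_nonneg (hG u) p
  have e1 : l⁻¹ * l ^ p = l ^ (p - 1) := by
    rw [Real.rpow_sub_one hl0.ne']; field_simp
  have e2 : l⁻¹ * ((p - 1) * (S.card * Z + S.card * Z)) ≤ h / 2 * Z := by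
    have : l⁻¹ * ((p - 1) * (S.card * Z + S.card * Z)) = ((p - 1) / p) * (h / 2 * Z) := by
      rw [hl]; field_simp; ring
    rw [this]
    exact mul_le_of_le_one_left (by positivity) (by rw [div_le_one hp0]; linarith)
  have h4 : h / 2 * Z ≤ l ^ (p - 1) * E := by
    have : l⁻¹ * (l ^ p * E + (p - 1) * (S.card * Z + S.card * Z)) =
      (l⁻¹ * l ^ p) * E + l⁻¹ * ((p - 1) * (S.card * Z + S.card * Z)) := by ring
    rw [this, e1] at h2
    linarith
  calc Z = 2 / h * (h / 2 * Z) := by field_simp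
    _ ≤ 2 / h * (l ^ (p - 1) * E) := by gcongr
    _ = _ := by ring

lemma exists_median {V : Type*} [Fintype V] [Nonempty V] (F : V → ℝ) : ∃ m,
    2 * (Finset.univ.filter fun u => m < F u).card ≤ Fintype.card V ∧
    2 * (Finset.univ.filter fun u => F u < m).card ≤ Fintype.card V := by
  classical
  -- the median is the smallest value exceeded by at most half of the values
  set Y := Finset.univ.filter fun v =>
    2 * (Finset.univ.filter fun u => F v < F u).card ≤ Fintype.card V with hY
  have hYne : Y.Nonempty := by
    obtain ⟨v, -, hv⟩ := Finset.univ.exists_max_image F Finset.univ_nonempty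
    refine ⟨v, ?_⟩
    have : (Finset.univ.filter fun u => F v < F u) = ∅ := by
      ext u; simpa using hv u (Finset.mem_univ u)
    simp [hY, this]
  obtain ⟨v, hv, hmin⟩ := Y.exists_min_image F hYne
  refine ⟨F v, by simpa [hY] using hv, ?_⟩
  by_contra! hlt
  have hne : (Finset.univ.filter fun u => F u < F v).Nonempty := by
    rw [← Finset.card_pos]; omega
  obtain ⟨w, hw, hmax⟩ := Finset.exists_max_image _ F hne
  have hw' : F w < F v := by simpa using hw
  have hwY : w ∉ Y := fun h => absurd (hmin w h) (not_le.2 hw')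
  have h1 : (Finset.univ.filter fun u => F w < F u) ⊆
      (Finset.univ.filter fun u => F u < F v)ᶜ := by
    intro u hu
    simp only [Finset.mem_compl, Finset.mem_filter, Finset.mem_univ, true_and] at hu ⊢
    exact fun h => absurd (hmax u (by simpa using h)) (not_le.2 hu)
  have h2 := Finset.card_le_card h1
  rw [Finset.card_compl] at h2
  simp only [hY, Finset.mem_filter, Finset.mem_univ, true_and, not_le] at hwY
  omega

/-- The `ℓ^p`-Poincaré inequality on a finite group that follows from an isoperimetric inequality:
the co-area inequality is applied to the `p`-th powers of the positive and negative parts of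
`F - m`, with `m` a median of `F`. -/
lemma Isoperimetric.poincare {S : Finset Γ} {h : ℝ} (hS : Isoperimetric S h) (hh : 0 < h)
    (hd : S.Nonempty) {p : ℝ} (hp : 1 ≤ p) (F : Γ → ℝ) :
    ∑ u, ∑ g, |F (u * g) - F u| ^ p ≤ 2 ^ p * (4 / h * (4 * p * S.card / h) ^ (p - 1)) *
      (Fintype.card Γ * ∑ u, ∑ s ∈ S, |F (u * s) - F u| ^ p) := by
  have hp0 : 0 < p := by linarith
  obtain ⟨m, hm1, hm2⟩ := exists_median F
  set E := ∑ u, ∑ s ∈ S, |F (u * s) - F u| ^ p with hE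
  set c := 2 / h * (4 * p * S.card / h) ^ (p - 1) with hc
  have hc0 : 0 ≤ c := by positivity
  have part : ∀ G : Γ → ℝ, (∀ u, 0 ≤ G u) → (∀ u v, |G u - G v| ≤ |F u - F v|) →
      2 * (Finset.univ.filter fun u => 0 < G u).card ≤ Fintype.card Γ →
      ∑ u, G u ^ p ≤ c * E := by
    intro G hG hGF hs
    refine (hS.sum_rpow_le hh hd hp G hG hs).trans (mul_le_mul_of_nonneg_left ?_ hc0)
    exact Finset.sum_le_sum fun u _ => Finset.sum_le_sum fun s _ =>
      Real.rpow_le_rpow (abs_nonneg _) (hGF _ _) hp0.le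
  have hpos := part (fun u => max (F u - m) 0) (fun u => le_max_right _ _)
    (fun u v => by simpa using abs_max_sub_max_le_abs (F u - m) (F v - m) 0)
    (by simpa [lt_max_iff, sub_pos] using hm1)
  have hneg := part (fun u => max (m - F u) 0) (fun u => le_max_right _ _)
    (fun u v => by
      simpa [abs_sub_comm] using abs_max_sub_max_le_abs (m - F u) (m - F v) 0)
    (by simpa [lt_max_iff, sub_pos] using hm2)
  have hsum : ∑ u, |F u - m| ^ p ≤ 2 * c * E := by
    calc ∑ u, |F u - m| ^ p ≤ ∑ u, (max (F u - m) 0 ^ p + max (m - F u) 0 ^ p) := by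
          refine Finset.sum_le_sum fun u _ => ?_
          rcases le_total m (F u) with hu | hu
          · rw [max_eq_left (sub_nonneg.2 hu), max_eq_right (sub_nonpos.2 hu),
              abs_of_nonneg (sub_nonneg.2 hu), Real.zero_rpow hp0.ne', add_zero]
          · rw [max_eq_right (sub_nonpos.2 hu), max_eq_left (sub_nonneg.2 hu),
              abs_sub_comm, abs_of_nonneg (sub_nonneg.2 hu), Real.zero_rpow hp0.ne', zero_add]
      _ ≤ 2 * c * E := by rw [Finset.sum_add_distrib]; linarith
  calc ∑ u, ∑ g, |F (u * g) - F u| ^ p = ∑ u, ∑ v, |F v - F u| ^ p :=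
        Finset.sum_congr rfl fun u _ => Equiv.sum_comp (Equiv.mulLeft u) fun v => |F v - F u| ^ p
    _ ≤ ∑ u, ∑ v, 2 ^ (p - 1) * (|F v - m| ^ p + |F u - m| ^ p) := by
        refine Finset.sum_le_sum fun u _ => Finset.sum_le_sum fun v _ => ?_
        have := abs_add_rpow_le hp (F v - m) (m - F u)
        rwa [sub_add_sub_cancel, abs_sub_comm m] at this
    _ = 2 ^ p * (Fintype.card Γ * ∑ u, |F u - m| ^ p) := by
        simp only [← Finset.mul_sum, Finset.sum_add_distrib, Finset.sum_const, nsmul_eq_mul,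
          Finset.card_univ]
        rw [Real.rpow_sub_one two_ne_zero]; ring
    _ ≤ 2 ^ p * (Fintype.card Γ * (2 * c * E)) := by gcongr
    _ = _ := by rw [hc]; ring

end Isoperimetry

/-! ### Powers of a finite group -/

section Translation

variable {K : Type*} [Group K] [Fintype K]

/-- The `p`-th power of the `ℓ^p` distance between `F` and its right translate by `ψ`. -/
noncomputable def translationEnergy (p : ℝ) (F : K → ℝ) (ψ : K) : ℝ := ∑ φ, |F (φ * ψ) - F φ| ^ p

lemma translationEnergy_nonneg (p : ℝ) (F : K → ℝ) (ψ : K) : 0 ≤ translationEnergy p F ψ :=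
  Finset.sum_nonneg fun _ _ => Real.rpow_nonneg (abs_nonneg _) p

/-- The `ℓ^p` distance between a function and its translates is a length function: this is
Minkowski's inequality and the invariance of the counting measure. -/
lemma translationEnergy_mul_rpow_le {p : ℝ} (hp : 1 ≤ p) (F : K → ℝ) (ψ χ : K) :
    translationEnergy p F (ψ * χ) ^ (1 / p) ≤
      translationEnergy p F ψ ^ (1 / p) + translationEnergy p F χ ^ (1 / p) := by
  have h := Real.Lp_add_le Finset.univ (fun φ => F (φ * ψ) - F φ)
    (fun φ => F (φ * ψ * χ) - F (φ * ψ)) hp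
  have e : ∑ φ, |F (φ * ψ * χ) - F (φ * ψ)| ^ p = translationEnergy p F χ :=
    Equiv.sum_comp (Equiv.mulRight ψ) fun φ => |F (φ * χ) - F φ| ^ p
  rw [e] at h
  simpa [translationEnergy, mul_assoc] using h

variable {Γ ι : Type*} [Group Γ] [Fintype Γ] [Fintype ι] [DecidableEq ι]

lemma translationEnergy_rpow_le_sum {p : ℝ} (hp : 1 ≤ p) (F : (ι → Γ) → ℝ) (ψ : ι → Γ) :
    translationEnergy p F ψ ≤ (Fintype.card ι : ℝ) ^ (p - 1) *
      ∑ x, translationEnergy p F (Pi.mulSingle x (ψ x)) := by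
  have hp0 : 0 < p := by linarith
  have key : ∀ t : Finset ι, translationEnergy p F (fun x => if x ∈ t then ψ x else 1) ^ (1 / p) ≤
      ∑ x ∈ t, translationEnergy p F (Pi.mulSingle x (ψ x)) ^ (1 / p) := by
    intro t
    induction t using Finset.induction_on with
    | empty =>
      have : (fun x : ι => if x ∈ (∅ : Finset ι) then ψ x else 1) = 1 := by ext; simp
      rw [this]
      simp [translationEnergy, hp0.ne']
    | insert y t hy ih =>
      have : (fun x => if x ∈ insert y t then ψ x else 1) =
          Pi.mulSingle y (ψ y) * fun x => if x ∈ t then ψ x else 1 := by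
        ext x
        rcases eq_or_ne x y with rfl | hx
        · simp [hy]
        · simp [hx]
      rw [this, Finset.sum_insert hy]
      exact (translationEnergy_mul_rpow_le hp F _ _).trans (add_le_add_right ih _)
  have h1 := key Finset.univ
  simp only [Finset.mem_univ, if_true] at h1
  have h0 : ∀ χ, 0 ≤ translationEnergy p F χ ^ (1 / p) := fun χ =>
    Real.rpow_nonneg (translationEnergy_nonneg p F χ) _
  have hr : ∀ χ, (translationEnergy p F χ ^ (1 / p)) ^ p = translationEnergy p F χ := fun χ => by
    rw [← Real.rpow_mul (translationEnergy_nonneg p F χ), one_div_mul_cancel hp0.ne',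
      Real.rpow_one]
  have h2 := Real.rpow_le_rpow (h0 _) h1 hp0.le
  have h3 := Real.rpow_sum_le_const_mul_sum_rpow Finset.univ
    (fun x => translationEnergy p F (Pi.mulSingle x (ψ x)) ^ (1 / p)) hp
  simp only [abs_of_nonneg (h0 _), hr, Finset.card_univ] at h2 h3
  exact h2.trans h3

lemma card_mul_sum_comp_eval (x : ι) (H : Γ → ℝ) :
    (Fintype.card Γ : ℝ) * ∑ ψ : ι → Γ, H (ψ x) = Fintype.card (ι → Γ) * ∑ g, H g := by
  calc (Fintype.card Γ : ℝ) * ∑ ψ : ι → Γ, H (ψ x)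
      = ∑ g : Γ, ∑ ψ : ι → Γ, H ((ψ * (Pi.mulSingle x g : ι → Γ)) x) := by
        have : ∀ g : Γ, ∑ ψ : ι → Γ, H ((ψ * (Pi.mulSingle x g : ι → Γ)) x) =
            ∑ ψ : ι → Γ, H (ψ x) := fun g =>
          Equiv.sum_comp (Equiv.mulRight (Pi.mulSingle x g : ι → Γ)) fun ψ : ι → Γ => H (ψ x)
        rw [Finset.sum_congr rfl fun g _ => this g]; simp
    _ = ∑ ψ : ι → Γ, ∑ g : Γ, H (ψ x * g) := by
        rw [Finset.sum_comm]; simp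
    _ = ∑ ψ : ι → Γ, ∑ g : Γ, H g :=
        Finset.sum_congr rfl fun ψ _ => Equiv.sum_comp (Equiv.mulLeft (ψ x)) H
    _ = _ := by simp

/-- The Poincaré inequality of `Γ`, applied to a single coordinate of the power `ι → Γ`. -/
lemma Isoperimetric.sum_translationEnergy_mulSingle_le {S : Finset Γ} {h : ℝ}
    (hS : Isoperimetric S h) (hh : 0 < h) (hd : S.Nonempty) {p : ℝ} (hp : 1 ≤ p)
    (F : (ι → Γ) → ℝ) (x : ι) :
    ∑ g, translationEnergy p F (Pi.mulSingle x g) ≤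
      2 ^ p * (4 / h * (4 * p * S.card / h) ^ (p - 1)) *
        (Fintype.card Γ * ∑ s ∈ S, translationEnergy p F (Pi.mulSingle x s)) := by
  have hN : (0 : ℝ) < Fintype.card Γ := by exact_mod_cast Fintype.card_pos
  -- averaging over the right translates by the elements of the coordinate subgroup
  have tr : ∀ T : Finset Γ, Fintype.card Γ * ∑ g ∈ T, translationEnergy p F (Pi.mulSingle x g) =
      ∑ φ, ∑ u, ∑ g ∈ T,
        |F (φ * (Pi.mulSingle x (u * g) : ι → Γ)) - F (φ * (Pi.mulSingle x u : ι → Γ))| ^ p := by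
    intro T
    have h1 : ∀ g u : Γ, ∑ φ : ι → Γ,
        |F (φ * (Pi.mulSingle x (u * g) : ι → Γ)) - F (φ * (Pi.mulSingle x u : ι → Γ))| ^ p =
        translationEnergy p F (Pi.mulSingle x g) := by
      intro g u
      simp only [Pi.mulSingle_mul, ← mul_assoc]
      exact Equiv.sum_comp (Equiv.mulRight (Pi.mulSingle x u : ι → Γ))
        fun φ : ι → Γ => |F (φ * (Pi.mulSingle x g : ι → Γ)) - F φ| ^ p
    rw [Finset.sum_comm]
    have h2 : ∀ u : Γ, ∑ φ : ι → Γ, ∑ g ∈ T,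
        |F (φ * (Pi.mulSingle x (u * g) : ι → Γ)) - F (φ * (Pi.mulSingle x u : ι → Γ))| ^ p =
        ∑ g ∈ T, translationEnergy p F (Pi.mulSingle x g) := by
      intro u
      rw [Finset.sum_comm]
      exact Finset.sum_congr rfl fun g _ => h1 g u
    simp [h2]
  refine le_of_mul_le_mul_left ?_ hN
  rw [tr]
  calc ∑ φ : ι → Γ, ∑ u, ∑ g,
        |F (φ * (Pi.mulSingle x (u * g) : ι → Γ)) - F (φ * (Pi.mulSingle x u : ι → Γ))| ^ p
      ≤ ∑ φ : ι → Γ, 2 ^ p * (4 / h * (4 * p * S.card / h) ^ (p - 1)) *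
          (Fintype.card Γ * ∑ u, ∑ s ∈ S,
            |F (φ * (Pi.mulSingle x (u * s) : ι → Γ)) - F (φ * (Pi.mulSingle x u : ι → Γ))| ^ p) :=
        Finset.sum_le_sum fun φ _ => hS.poincare hh hd hp
          fun u => F (φ * (Pi.mulSingle x u : ι → Γ))
    _ = _ := by
        simp only [← Finset.mul_sum, ← tr]; ring

/-- The Poincaré inequality of `Γ` passes to the power `ι → Γ`, with a loss that is linear in the
number of factors. -/
lemma Isoperimetric.sum_translationEnergy_le {S : Finset Γ} {h : ℝ}
    (hS : Isoperimetric S h) (hh : 0 < h) (hd : S.Nonempty) {p : ℝ} (hp : 1 ≤ p)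
    (F : (ι → Γ) → ℝ) {R : ℝ}
    (hR : ∀ x, ∀ s ∈ S, translationEnergy p F (Pi.mulSingle x s) ≤ R) :
    ∑ ψ, translationEnergy p F ψ ≤ (2 * (4 * p * S.card / h) * Fintype.card ι) ^ p *
      (Fintype.card (ι → Γ) * R) := by
  rcases isEmpty_or_nonempty ι with hι | hι
  · have h1 : ∀ ψ : ι → Γ, translationEnergy p F ψ = 0 := fun ψ => by
      rw [Subsingleton.elim ψ 1]
      simp [translationEnergy, show p ≠ 0 by linarith]
    simp [h1, show p ≠ 0 by linarith]
  have hp0 : 0 < p := by linarith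
  have hd' : (1 : ℝ) ≤ S.card := by exact_mod_cast hd.card_pos
  have hN : (0 : ℝ) < Fintype.card Γ := by exact_mod_cast Fintype.card_pos
  have hn : (0 : ℝ) < Fintype.card ι := by exact_mod_cast Fintype.card_pos
  set c := 2 ^ p * (4 / h * (4 * p * S.card / h) ^ (p - 1)) with hc
  have hc0 : 0 ≤ c := by positivity
  have hR0 : 0 ≤ R := by
    obtain ⟨s, hs⟩ := hd
    exact (translationEnergy_nonneg p F _).trans (hR (Classical.arbitrary ι) s hs)
  have h1 : ∀ x : ι, ∑ ψ : ι → Γ, translationEnergy p F (Pi.mulSingle x (ψ x)) ≤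
      Fintype.card (ι → Γ) * (c * (S.card * R)) := by
    intro x
    refine le_of_mul_le_mul_left ?_ hN
    rw [card_mul_sum_comp_eval x fun g => translationEnergy p F (Pi.mulSingle x g)]
    have h2 := hS.sum_translationEnergy_mulSingle_le hh hd hp F x
    have h3 : ∑ s ∈ S, translationEnergy p F (Pi.mulSingle x s) ≤ S.card * R := by
      simpa using Finset.sum_le_sum (hR x)
    calc (Fintype.card (ι → Γ) : ℝ) * ∑ g, translationEnergy p F (Pi.mulSingle x g)
        ≤ Fintype.card (ι → Γ) * (c * (Fintype.card Γ * (S.card * R))) := by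
          refine mul_le_mul_of_nonneg_left (h2.trans ?_) (by positivity)
          gcongr
      _ = _ := by ring
  have hcS : c * S.card ≤ (2 * (4 * p * S.card / h)) ^ p := by
    have hl : 0 < 4 * p * S.card / h := by positivity
    rw [Real.mul_rpow (by norm_num) hl.le, hc, mul_assoc]
    refine mul_le_mul_of_nonneg_left ?_ (by positivity)
    rw [Real.rpow_sub_one hl.ne']
    have : 4 / h * ((4 * p * S.card / h) ^ p / (4 * p * S.card / h)) * S.card =
        (4 * p * S.card / h) ^ p / p := by
      field_simp
    rw [this]
    exact div_le_self (by positivity) hp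
  calc ∑ ψ, translationEnergy p F ψ
      ≤ ∑ ψ : ι → Γ, (Fintype.card ι : ℝ) ^ (p - 1) *
          ∑ x, translationEnergy p F (Pi.mulSingle x (ψ x)) :=
        Finset.sum_le_sum fun ψ _ => translationEnergy_rpow_le_sum hp F ψ
    _ = (Fintype.card ι : ℝ) ^ (p - 1) *
          ∑ x, ∑ ψ : ι → Γ, translationEnergy p F (Pi.mulSingle x (ψ x)) := by
        rw [← Finset.mul_sum, Finset.sum_comm]
    _ ≤ (Fintype.card ι : ℝ) ^ (p - 1) *
          ∑ _x : ι, Fintype.card (ι → Γ) * (c * (S.card * R)) := by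
        gcongr with x; exact h1 x
    _ = (Fintype.card ι : ℝ) ^ p * (c * S.card) * (Fintype.card (ι → Γ) * R) := by
        rw [Real.rpow_sub_one hn.ne', Finset.sum_const, Finset.card_univ, nsmul_eq_mul]
        field_simp
    _ ≤ (Fintype.card ι : ℝ) ^ p * (2 * (4 * p * S.card / h)) ^ p *
          (Fintype.card (ι → Γ) * R) := by gcongr
    _ = _ := by
        rw [Real.mul_rpow (by positivity : (0:ℝ) ≤ 2 * (4 * p * S.card / h)) hn.le]; ring

end Translation

/-! ### Lamps and a cursor on a segment -/

lemma sum_abs_sub_avg_rpow_le {V : Type*} [Fintype V] [Nonempty V] {p : ℝ} (hp : 1 ≤ p)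
    (f : V → ℝ) :
    (Fintype.card V : ℝ) * ∑ v, |f v - avg f| ^ p ≤ ∑ v, ∑ w, |f v - f w| ^ p := by
  have hV : (0 : ℝ) < Fintype.card V := by exact_mod_cast Fintype.card_pos
  have hp0 : 0 < p := by linarith
  rw [Finset.mul_sum]
  refine Finset.sum_le_sum fun v _ => ?_
  have h1 : Fintype.card V * |f v - avg f| = |∑ w, (f v - f w)| := by
    nth_rewrite 1 [← abs_of_pos hV]
    rw [← abs_mul, avg]
    congr 1
    rw [Finset.sum_sub_distrib, mul_sub, mul_div_cancel₀ _ hV.ne']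
    simp
  have h2 : (Fintype.card V * |f v - avg f|) ^ p ≤
      (Fintype.card V : ℝ) ^ (p - 1) * ∑ w, |f v - f w| ^ p := by
    rw [h1]
    exact (Real.rpow_le_rpow (abs_nonneg _) (Finset.abs_sum_le_sum_abs _ _) hp0.le).trans
      (Real.rpow_sum_le_const_mul_sum_rpow Finset.univ (fun w => f v - f w) hp)
  rw [Real.mul_rpow hV.le (abs_nonneg _)] at h2
  refine le_of_mul_le_mul_left ?_ (Real.rpow_pos_of_pos hV (p - 1))
  rw [← mul_assoc, ← Real.rpow_add_one hV.ne', sub_add_cancel]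
  exact h2

lemma abs_sub_le_sum_of_steps {L : ℕ} (F D : Fin L → ℝ) (hD : ∀ i, 0 ≤ D i)
    (hF : ∀ i j : Fin L, (j : ℕ) = i + 1 → |F j - F i| ≤ D i) (i j : Fin L) :
    |F j - F i| ≤ ∑ l, D l := by
  wlog hij : i ≤ j generalizing i j
  · rw [abs_sub_comm]; exact this j i (le_of_not_ge hij)
  let g : ℕ → ℝ := fun n => if h : n < L then F ⟨n, h⟩ else 0
  let d : ℕ → ℝ := fun n => if h : n < L then D ⟨n, h⟩ else 0
  have h1 : dist (g i) (g j) ≤ ∑ l ∈ Finset.Ico (i : ℕ) j, d l := by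
    refine dist_le_Ico_sum_of_dist_le hij fun {n} _ hn => ?_
    have h2 : n + 1 < L := by omega
    have h3 : n < L := by omega
    simp only [g, d, h2, h3, dif_pos]
    rw [dist_comm, Real.dist_eq]
    exact hF _ _ rfl
  have h2 : ∑ l ∈ Finset.Ico (i : ℕ) j, d l ≤ ∑ l ∈ Finset.range L, d l := by
    refine Finset.sum_le_sum_of_subset_of_nonneg ?_ ?_
    · intro n hn
      rw [Finset.mem_Ico] at hn
      rw [Finset.mem_range]; omega
    · intro n _ _
      by_cases h : n < L <;> simp [d, h, hD]
  rw [Finset.sum_range, dist_comm, Real.dist_eq] at *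
  simpa [g, d] using h1.trans h2

section LampCursor

variable {Γ ι : Type*} [Group Γ] [Fintype Γ] [Fintype ι] [DecidableEq ι]

/-- The `ℓ^p`-Poincaré inequality for lamp configurations on `ι` together with a cursor on a
segment of length `L`, when the lamp at each `x` can be changed by each `s ∈ S` at some position
`j` of the cursor; `D` bounds the variation of `f` along these moves. A lamp is changed at an
arbitrary position of the cursor by moving to `j`, changing the lamp there, and moving back. -/
lemma Isoperimetric.lampCursor_poincare {S : Finset Γ} {h : ℝ} (hS : Isoperimetric S h)
    (hh : 0 < h) (hd : S.Nonempty) (hhd : h ≤ S.card) [Nonempty ι] {p : ℝ} (hp : 1 ≤ p) {L : ℕ}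
    (hL : 0 < L) (f D : (ι → Γ) × Fin L → ℝ) (hD : ∀ v, 0 ≤ D v)
    (hmove : ∀ φ (i j : Fin L), (j : ℕ) = i + 1 → |f (φ, j) - f (φ, i)| ≤ D (φ, i))
    (hlamp : ∀ x, ∀ s ∈ S, ∃ j, ∀ φ, |f (φ * Pi.mulSingle x s, j) - f (φ, j)| ≤ D (φ, j)) :
    ∑ v, |f v - avg f| ^ p ≤
      (48 * p * S.card * Fintype.card ι * L / h) ^ p * ∑ v, D v ^ p := by
  have hp0 : 0 < p := by linarith
  have : Nonempty (Fin L) := ⟨⟨0, hL⟩⟩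
  have hL' : (1 : ℝ) ≤ L := by exact_mod_cast hL
  have hL0 : (0 : ℝ) < L := by linarith
  have hn : (1 : ℝ) ≤ Fintype.card ι := by exact_mod_cast Fintype.card_pos
  have hd' : (0 : ℝ) < S.card := by exact_mod_cast hd.card_pos
  have hK : (0 : ℝ) < Fintype.card (ι → Γ) := by exact_mod_cast Fintype.card_pos
  set R := ∑ v, D v ^ p with hR
  have hR0 : 0 ≤ R := Finset.sum_nonneg fun v _ => Real.rpow_nonneg (hD v) p
  have hRK : R = ∑ φ, ∑ i, D (φ, i) ^ p := Fintype.sum_prod_type _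
  set Q := (L : ℝ) ^ (p - 1) * R with hQ
  have hRQ : R ≤ Q := le_mul_of_one_le_left hR0 (Real.one_le_rpow hL' (by linarith))
  have hQ0 : 0 ≤ Q := hR0.trans hRQ
  have hmoveQ : ∀ i j, ∑ φ, |f (φ, j) - f (φ, i)| ^ p ≤ Q := by
    intro i j
    rw [hQ, hRK, Finset.mul_sum]
    refine Finset.sum_le_sum fun φ _ => ?_
    have h1 := abs_sub_le_sum_of_steps (fun i => f (φ, i)) (fun i => D (φ, i))
      (fun i => hD _) (hmove φ) i j
    have h2 := Real.rpow_sum_le_const_mul_sum_rpow Finset.univ (fun i => D (φ, i)) hp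
    simp only [abs_of_nonneg (hD _), Finset.card_univ, Fintype.card_fin] at h2
    exact (Real.rpow_le_rpow (abs_nonneg _) h1 hp0.le).trans h2
  have hgen : ∀ i x, ∀ s ∈ S,
      translationEnergy p (fun φ => f (φ, i)) (Pi.mulSingle x s) ≤ 3 ^ p * Q := by
    intro i x s hs
    obtain ⟨j, hj⟩ := hlamp x s hs
    calc translationEnergy p (fun φ => f (φ, i)) (Pi.mulSingle x s)
        ≤ ∑ φ, 3 ^ (p - 1) * (|f (φ * Pi.mulSingle x s, i) - f (φ * Pi.mulSingle x s, j)| ^ p +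
            |f (φ * Pi.mulSingle x s, j) - f (φ, j)| ^ p + |f (φ, j) - f (φ, i)| ^ p) := by
          refine Finset.sum_le_sum fun φ _ => ?_
          have := abs_add_three_rpow_le hp
            (f (φ * Pi.mulSingle x s, i) - f (φ * Pi.mulSingle x s, j))
            (f (φ * Pi.mulSingle x s, j) - f (φ, j)) (f (φ, j) - f (φ, i))
          simpa using this
      _ ≤ 3 ^ (p - 1) * (Q + Q + Q) := by
          rw [← Finset.mul_sum, Finset.sum_add_distrib, Finset.sum_add_distrib]
          refine mul_le_mul_of_nonneg_left (add_le_add (add_le_add ?_ ?_) (hmoveQ i j))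
            (by positivity)
          · exact (Equiv.sum_comp (Equiv.mulRight (Pi.mulSingle x s : ι → Γ))
              fun φ => |f (φ, i) - f (φ, j)| ^ p).trans_le (hmoveQ j i)
          · refine le_trans ?_ hRQ
            rw [hRK]
            refine Finset.sum_le_sum fun φ _ => ?_
            exact (Real.rpow_le_rpow (abs_nonneg _) (hj φ) hp0.le).trans
              (Finset.single_le_sum (f := fun i => D (φ, i) ^ p)
                (fun i _ => Real.rpow_nonneg (hD _) p) (Finset.mem_univ j))
      _ = 3 ^ p * Q := by rw [Real.rpow_sub_one three_ne_zero]; ring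
  set c := 2 * (4 * p * S.card / h) * Fintype.card ι with hc
  have hc1 : 1 ≤ c := by
    have : 1 ≤ S.card / h := by rwa [le_div_iff₀ hh, one_mul]
    have h2 : (1 : ℝ) ≤ p * (S.card / h) := by nlinarith
    have h3 : (1 : ℝ) ≤ p * (S.card / h) * Fintype.card ι := by nlinarith
    calc (1 : ℝ) ≤ 8 * (p * (S.card / h) * Fintype.card ι) := by linarith
      _ = c := by rw [hc]; ring
  have hfix : ∀ i, ∑ ψ, translationEnergy p (fun φ => f (φ, i)) ψ ≤
      c ^ p * (Fintype.card (ι → Γ) * (3 ^ p * Q)) :=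
    fun i => hS.sum_translationEnergy_le hh hd hp _ (hgen i)
  -- `(φ, i)` is joined to `(ψ, j)` through `(ψ, i)`
  have hpairs : ∑ v, ∑ w, |f v - f w| ^ p ≤
      2 ^ p * L ^ 2 * Fintype.card (ι → Γ) * ((3 * c) ^ p * Q) := by
    calc ∑ v, ∑ w, |f v - f w| ^ p
        = ∑ φ, ∑ i, ∑ ψ, ∑ j, |f (φ, i) - f (ψ, j)| ^ p := by
          simp only [Fintype.sum_prod_type]
      _ ≤ ∑ φ, ∑ i, ∑ ψ, ∑ j,
            2 ^ (p - 1) * (|f (ψ, i) - f (φ, i)| ^ p + |f (ψ, j) - f (ψ, i)| ^ p) := by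
          refine Finset.sum_le_sum fun φ _ => Finset.sum_le_sum fun i _ =>
            Finset.sum_le_sum fun ψ _ => Finset.sum_le_sum fun j _ => ?_
          have := abs_add_rpow_le hp (f (ψ, i) - f (φ, i)) (f (ψ, j) - f (ψ, i))
          rwa [add_comm (f (ψ, i) - _), sub_add_sub_cancel, abs_sub_comm] at this
      _ = 2 ^ (p - 1) * (L * ∑ i, (∑ φ, ∑ ψ, |f (ψ, i) - f (φ, i)| ^ p) +
            Fintype.card (ι → Γ) * ∑ i, ∑ j, ∑ ψ, |f (ψ, j) - f (ψ, i)| ^ p) := by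
          rw [Finset.sum_comm]
          simp only [← Finset.mul_sum, Finset.sum_add_distrib, Finset.sum_const,
            Finset.card_univ, nsmul_eq_mul, Fintype.card_fin]
          congr 3
          exact Finset.sum_congr rfl fun i _ => Finset.sum_comm
      _ ≤ 2 ^ (p - 1) * (L * ∑ _i : Fin L, c ^ p * (Fintype.card (ι → Γ) * (3 ^ p * Q)) +
            Fintype.card (ι → Γ) * ∑ _i : Fin L, ∑ _j : Fin L, Q) := by
          gcongr with i _ i _ j _
          · refine le_trans (le_of_eq ?_) (hfix i)
            rw [Finset.sum_congr rfl fun φ _ => (Equiv.sum_comp (Equiv.mulLeft φ)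
              fun ψ => |f (ψ, i) - f (φ, i)| ^ p).symm, Finset.sum_comm]
            rfl
          · exact hmoveQ i j
      _ = 2 ^ (p - 1) * L ^ 2 * Fintype.card (ι → Γ) * ((3 * c) ^ p * Q + Q) := by
          rw [Real.mul_rpow (x := 3) (y := c) (by norm_num) (by linarith)]
          simp only [Finset.sum_const, Finset.card_univ, nsmul_eq_mul, Fintype.card_fin]
          ring
      _ ≤ 2 ^ (p - 1) * L ^ 2 * Fintype.card (ι → Γ) * ((3 * c) ^ p * Q + (3 * c) ^ p * Q) := by
          gcongr
          exact le_mul_of_one_le_left hQ0 (Real.one_le_rpow (by linarith) hp0.le)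
      _ = _ := by rw [Real.rpow_sub_one two_ne_zero]; ring
  have hV : (Fintype.card ((ι → Γ) × Fin L) : ℝ) = Fintype.card (ι → Γ) * L := by
    rw [Fintype.card_prod, Fintype.card_fin]; push_cast; rfl
  have h1 := (sum_abs_sub_avg_rpow_le hp f).trans hpairs
  rw [hV] at h1
  refine le_of_mul_le_mul_left (h1.trans_eq ?_) (mul_pos hK hL0)
  have e : 48 * p * S.card * Fintype.card ι * L / h = 2 * (3 * c) * L := by
    rw [hc]; ring
  rw [e, Real.mul_rpow (by positivity) hL0.le,
    Real.mul_rpow (x := 2) (y := 3 * c) (by norm_num) (by positivity), hQ,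
    Real.rpow_sub_one hL0.ne']
  generalize (3 * c) ^ p = W
  field_simp

end LampCursor

/-! ### Lamplighter groups and lamp configurations in a window -/

namespace Lamplighter

variable {Γ : Type*} [Group Γ]

@[simp] lemma dirac_lamp (i : ℤ) (g : Γ) (n : ℤ) :
    (dirac i g).lamp n = if n = i then g else 1 := rfl

@[simp] lemma dirac_cursor (i : ℤ) (g : Γ) : (dirac i g).cursor = 0 := rfl

@[simp] lemma shift_lamp (n : ℤ) : (shift : Lamplighter Γ).lamp n = 1 := rfl

@[simp] lemma shift_cursor : (shift : Lamplighter Γ).cursor = 1 := rfl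

lemma shift_zpow (j : ℤ) :
    (∀ n, ((shift : Lamplighter Γ) ^ j).lamp n = 1) ∧ ((shift : Lamplighter Γ) ^ j).cursor = j := by
  induction j using Int.induction_on with
  | zero => simp
  | succ i ih =>
    rw [zpow_add_one]
    exact ⟨fun n => by rw [mul_lamp, ih.1]; simp, by rw [mul_cursor, ih.2]; simp⟩
  | pred i ih =>
    rw [zpow_sub_one]
    exact ⟨fun n => by rw [mul_lamp, ih.1]; simp,
      by rw [mul_cursor, ih.2]; simp; ring⟩

@[simp] lemma shift_zpow_lamp (j n : ℤ) : ((shift : Lamplighter Γ) ^ j).lamp n = 1 :=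
  (shift_zpow j).1 n

@[simp] lemma shift_zpow_cursor (j : ℤ) : ((shift : Lamplighter Γ) ^ j).cursor = j :=
  (shift_zpow j).2

lemma shift_zpow_mul_dirac (i j : ℤ) (g : Γ) :
    shift ^ j * dirac i g = dirac (i + j) g * shift ^ j := by
  ext n
  · simp [sub_eq_iff_eq_add]
  · simp

end Lamplighter

section LampHom

variable {A B Γ : Type*} [Group A] [Group B] [Group Γ] (a : A →* Γ) (b : B →* Γ) (k : ℕ)

@[simp] lemma lampHom_inA (u : A) :
    lampHom a b k (FreeLampGroup.inA A B u) = Lamplighter.dirac (-(k : ℤ)) (a u) := by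
  simp [lampHom, FreeLampGroup.inA]

@[simp] lemma lampHom_inB (v : B) :
    lampHom a b k (FreeLampGroup.inB A B v) = Lamplighter.dirac (k : ℤ) (b v) := by
  simp [lampHom, FreeLampGroup.inB]

@[simp] lemma lampHom_tau : lampHom a b k (FreeLampGroup.tau A B) = Lamplighter.shift := by
  simp [lampHom, FreeLampGroup.tau]

end LampHom

section Projections

variable {A B Γ : Type*} [Group A] [Group B] [Finite A] [Finite B] [Group Γ]

open scoped commutatorElement in
/-- If killing the commutators of the images of `A` and `B` gives a group isomorphic to the product
of these images, then `Γ` has canonical projections to `A` and `B`. The given isomorphism need not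
be compatible with `a` and `b`, but it makes the canonical surjection of `A × B` onto the quotient
bijective, by counting. -/
lemma exists_factor_projections {a : A →* Γ} {b : B →* Γ} (ha : Function.Injective a)
    (hb : Function.Injective b)
    (hgen : Subgroup.closure ((a.range : Set Γ) ∪ (b.range : Set Γ)) = ⊤)
    (hquot : Nonempty ((Γ ⧸ Subgroup.normalClosure ((⁅a.range, b.range⁆ : Subgroup Γ) : Set Γ)) ≃*
      (a.range × b.range))) :
    ∃ (θA : Γ →* A) (θB : Γ →* B), (∀ u, θA (a u) = u) ∧ (∀ v, θA (b v) = 1) ∧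
      (∀ u, θB (a u) = 1) ∧ ∀ v, θB (b v) = v := by
  obtain ⟨e⟩ := hquot
  set M := Subgroup.normalClosure ((⁅a.range, b.range⁆ : Subgroup Γ) : Set Γ)
  set q := QuotientGroup.mk' M
  have hcomm : ∀ u v, Commute (q.comp a u) (q.comp b v) := by
    intro u v
    rw [commute_iff_eq, ← commutatorElement_eq_one_iff_mul_comm]
    have : (⁅a u, b v⁆ : Γ) ∈ M := Subgroup.subset_normalClosure
      (Subgroup.commutator_mem_commutator ⟨u, rfl⟩ ⟨v, rfl⟩)
    have h1 := (QuotientGroup.eq_one_iff (N := M) _).2 this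
    exact (map_commutatorElement q _ _).symm.trans h1
  set ψ := (q.comp a).noncommCoprod (q.comp b) hcomm
  have hψ : ∀ x, ψ x = q (a x.1) * q (b x.2) := fun x => rfl
  have hsurj : Function.Surjective ψ := by
    have htop : (⊤ : Subgroup Γ) ≤ ψ.range.comap q := by
      rw [← hgen, Subgroup.closure_le]
      rintro _ (⟨u, rfl⟩ | ⟨v, rfl⟩)
      · exact ⟨(u, 1), by simp [hψ]⟩
      · exact ⟨(1, v), by simp [hψ]⟩
    intro y
    obtain ⟨g, rfl⟩ := QuotientGroup.mk'_surjective M y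
    exact htop (Subgroup.mem_top g)
  have hcard : Nat.card (A × B) = Nat.card (Γ ⧸ M) := by
    rw [Nat.card_congr e.toEquiv, Nat.card_prod, Nat.card_prod,
      Nat.card_congr (MonoidHom.ofInjective ha).toEquiv,
      Nat.card_congr (MonoidHom.ofInjective hb).toEquiv]
  have hbij := (Nat.bijective_iff_surjective_and_card ψ).2 ⟨hsurj, hcard⟩
  set E := MulEquiv.ofBijective ψ hbij
  have hA : ∀ u, E.symm (q (a u)) = (u, 1) := fun u => by
    rw [MulEquiv.symm_apply_eq]; simp [E, hψ]
  have hB : ∀ v, E.symm (q (b v)) = (1, v) := fun v => by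
    rw [MulEquiv.symm_apply_eq]; simp [E, hψ]
  refine ⟨(MonoidHom.fst A B).comp (E.symm.toMonoidHom.comp q),
    (MonoidHom.snd A B).comp (E.symm.toMonoidHom.comp q), ?_, ?_, ?_, ?_⟩ <;> intro u <;>
    simp [hA, hB]

end Projections

section Configurations

variable {Γ : Type*} [Group Γ]

/-- The lamp configurations supported in `[-r, r]`, indexed by that interval only. -/
abbrev LampWindow (Γ : Type*) (r : ℕ) : Type _ := Finset.Icc (-(r : ℤ)) r → Γ

/-- Extension by the trivial lamp. -/
noncomputable def LampWindow.extend (r : ℕ) : LampWindow Γ r →* (ℤ → Γ) where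
  toFun f z := if h : z ∈ Finset.Icc (-(r : ℤ)) r then f ⟨z, h⟩ else 1
  map_one' := by ext z; simp
  map_mul' f g := by
    ext z
    by_cases h : z ∈ Finset.Icc (-(r : ℤ)) r
    · simp only [Pi.mul_apply, dif_pos h]
    · simp only [Pi.mul_apply, dif_neg h, one_mul]

namespace LampWindow

variable {r : ℕ}

lemma extend_of_not_mem (f : LampWindow Γ r) {z : ℤ} (h : ¬(-(r : ℤ) ≤ z ∧ z ≤ r)) :
    extend r f z = 1 := dif_neg (by rwa [Finset.mem_Icc])

lemma extend_coe (f : LampWindow Γ r) (x : Finset.Icc (-(r : ℤ)) r) : extend r f x = f x :=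
  dif_pos x.2

lemma extend_mulSingle (x : Finset.Icc (-(r : ℤ)) r) (g : Γ) (z : ℤ) :
    extend r (Pi.mulSingle x g) z = if z = x then g else 1 := by
  by_cases h : z ∈ Finset.Icc (-(r : ℤ)) r
  · lift z to Finset.Icc (-(r : ℤ)) r using h
    rw [extend_coe, Pi.mulSingle_apply]
    simp only [Subtype.ext_iff]
  · rw [extend_of_not_mem _ (by rwa [← Finset.mem_Icc]), if_neg]
    rintro rfl
    exact h x.2

/-- A homomorphism from configurations in a window to lamp configurations on `ℤ` yields elements of
the lamplighter group with the cursor at the origin. -/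
noncomputable def toLamplighter {Γ' : Type*} [Group Γ'] (c : LampWindow Γ r →* (ℤ → Γ'))
    (hc : ∀ f, (Function.mulSupport (c f)).Finite) : LampWindow Γ r →* Lamplighter Γ' where
  toFun f := ⟨c f, 0, hc f⟩
  map_one' := by ext n <;> simp
  map_mul' f g := by ext n <;> simp

lemma finite_mulSupport_extend (f : LampWindow Γ r) :
    (Function.mulSupport (extend r f)).Finite := by
  refine (Set.finite_Icc (-(r : ℤ)) r).subset fun z hz => ?_
  by_contra h
  exact hz (extend_of_not_mem f h)

lemma exists_hom_same :
    ∃ F : LampWindow Γ r →* Lamplighter Γ, (∀ f, (F f).cursor = 0) ∧ Function.Injective F ∧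
      ∀ x g, F (Pi.mulSingle x g) = Lamplighter.dirac x g := by
  refine ⟨toLamplighter (extend r) finite_mulSupport_extend, fun f => rfl, fun f g h => ?_,
    fun x g => ?_⟩
  · ext x
    have := congrArg (fun y => Lamplighter.lamp y x) h
    simpa [toLamplighter, extend_coe] using this
  · ext z
    · simp [toLamplighter, extend_mulSingle]
    · rfl

/-- A configuration `f` in a window of radius `r` prescribes factors in `A` and `B`, hence a lamp
configuration in any other group generated by `A` and `B`, in which the factors in `A` are moved by
`-d` and those in `B` by `d`. As `d` exceeds `r` in absolute value, no lamp of the new configuration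
receives factors of both kinds. -/
lemma exists_hom_other {A B Γ' : Type*} [Group A] [Group B] [Group Γ'] {a : A →* Γ} {b : B →* Γ}
    {θA : Γ →* A} {θB : Γ →* B} (hAA : ∀ u, θA (a u) = u) (hAB : ∀ v, θA (b v) = 1)
    (hBA : ∀ u, θB (a u) = 1) (hBB : ∀ v, θB (b v) = v) (a' : A →* Γ') (b' : B →* Γ') {d : ℤ}
    (hd : (r : ℤ) < |d|) :
    ∃ F : LampWindow Γ r →* Lamplighter Γ', (∀ f, (F f).cursor = 0) ∧
      (∀ x u, F (Pi.mulSingle x (a u)) = Lamplighter.dirac (x - d) (a' u)) ∧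
      ∀ x v, F (Pi.mulSingle x (b v)) = Lamplighter.dirac (x + d) (b' v) := by
  let c : LampWindow Γ r →* (ℤ → Γ') :=
    { toFun := fun f z => a' (θA (extend r f (z + d))) * b' (θB (extend r f (z - d)))
      map_one' := by ext z; simp
      map_mul' := fun f g => by
        ext z
        by_cases h : -(r : ℤ) ≤ z + d ∧ z + d ≤ r
        · have h' : ¬(-(r : ℤ) ≤ z - d ∧ z - d ≤ r) := by
            rintro ⟨h1, h2⟩
            exact absurd hd (not_lt.2 (abs_le.2 ⟨by omega, by omega⟩))
          simp [extend_of_not_mem _ h']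
        · simp [extend_of_not_mem _ h] }
  have hc : ∀ f, (Function.mulSupport (c f)).Finite := by
    intro f
    refine ((Set.finite_Icc (-(r : ℤ) - d) (r - d)).union
      (Set.finite_Icc (-(r : ℤ) + d) (r + d))).subset fun z hz => ?_
    by_contra h
    rw [Set.mem_union, not_or, Set.mem_Icc, Set.mem_Icc] at h
    refine hz ?_
    show a' (θA (extend r f (z + d))) * b' (θB (extend r f (z - d))) = 1
    rw [extend_of_not_mem f fun h' => h.1 ⟨by omega, by omega⟩,
      extend_of_not_mem f fun h' => h.2 ⟨by omega, by omega⟩]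
    simp
  refine ⟨toLamplighter c hc, fun f => rfl, fun x u => ?_, fun x v => ?_⟩
  · ext z
    · show a' (θA (extend r (Pi.mulSingle x (a u)) (z + d))) *
        b' (θB (extend r (Pi.mulSingle x (a u)) (z - d))) = if z = x - d then a' u else 1
      simp only [extend_mulSingle, apply_ite θA, apply_ite θB, hAA, hBA, map_one, ite_self,
        mul_one, apply_ite a', eq_sub_iff_add_eq]
    · rfl
  · ext z
    · show a' (θA (extend r (Pi.mulSingle x (b v)) (z + d))) *
        b' (θB (extend r (Pi.mulSingle x (b v)) (z - d))) = if z = x + d then b' v else 1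
      simp only [extend_mulSingle, apply_ite θA, apply_ite θB, hAB, hBB, map_one, ite_self,
        one_mul, apply_ite b', sub_eq_iff_eq_add]
    · rfl

end LampWindow

end Configurations

/-! ### Lifting configurations to the diagonal product -/

section Lift

variable {A B : Type*} [Group A] [Group B] {Γ : ℕ → Type*} [∀ s, Group (Γ s)]
  {a : ∀ s, A →* Γ s} {b : ∀ s, B →* Γ s} {k : ℕ → ℕ}

lemma two_mul_lt_of_lt (hk : ∀ s, 2 * k s < k (s + 1)) {t s : ℕ} (h : t < s) :
    2 * k t < k s := by
  induction s, h using Nat.le_induction with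
  | base => exact hk t
  | succ n _ ih => have := hk n; omega

lemma mk_eq_mk_iff_lampHom {x y : FreeLampGroup A B} :
    (x : LampDiagonalProduct a b k) = y ↔
      ∀ t, lampHom (a t) (b t) (k t) x = lampHom (a t) (b t) (k t) y := by
  simp [QuotientGroup.eq, lampKernel, Subgroup.mem_iInf, MonoidHom.mem_ker, inv_mul_eq_one]

open FreeLampGroup in
/-- The lamp configurations of `Γ_s` in the window `[-r, r]` lift to the diagonal product: the
configurations in the other groups `Γ_t` that are visited at the same time depend only on the
projections of `Γ_s` to `A` and `B`, because `k_t` differs from `k_s` by more than `r`. The lift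
respects the changes of the lamp at `x` made by `A` with the cursor at `x + k_s` and by `B` with the
cursor at `x - k_s`. -/
lemma exists_lift_lampWindow [Finite A] [Finite B] (ha : ∀ s, Function.Injective (a s))
    (hb : ∀ s, Function.Injective (b s))
    (hgen : ∀ s, Subgroup.closure (((a s).range : Set (Γ s)) ∪ ((b s).range : Set (Γ s))) = ⊤)
    (hquot : ∀ s, Nonempty
      ((Γ s ⧸ Subgroup.normalClosure
        ((⁅(a s).range, (b s).range⁆ : Subgroup (Γ s)) : Set (Γ s))) ≃*
        ((a s).range × (b s).range)))
    (hk : ∀ s, 2 * k s < k (s + 1)) (s r : ℕ) (hr : 2 * r ≤ k s) :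
    ∃ w : LampWindow (Γ s) r → FreeLampGroup A B,
      Function.Injective (fun f => lampHom (a s) (b s) (k s) (w f)) ∧
      (∀ f, (lampHom (a s) (b s) (k s) (w f)).cursor = 0) ∧
      (∀ f (x : Finset.Icc (-(r : ℤ)) r) u,
        ((w (f * (Pi.mulSingle x (a s u) : LampWindow (Γ s) r)) * tau A B ^ ((x : ℤ) + k s) :
          FreeLampGroup A B) : LampDiagonalProduct a b k) =
        (w f * tau A B ^ ((x : ℤ) + k s) * inA A B u : FreeLampGroup A B)) ∧
      (∀ f (x : Finset.Icc (-(r : ℤ)) r) v,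
        ((w (f * (Pi.mulSingle x (b s v) : LampWindow (Γ s) r)) * tau A B ^ ((x : ℤ) - k s) :
          FreeLampGroup A B) : LampDiagonalProduct a b k) =
        (w f * tau A B ^ ((x : ℤ) - k s) * inB A B v : FreeLampGroup A B)) := by
  obtain ⟨θA, θB, hAA, hAB, hBA, hBB⟩ :=
    exists_factor_projections (ha s) (hb s) (hgen s) (hquot s)
  have hF : ∀ t, ∃ F : LampWindow (Γ s) r →* Lamplighter (Γ t),
      (∀ f, (F f).cursor = 0) ∧ (t = s → Function.Injective F) ∧
      (∀ x u, F (Pi.mulSingle x (a s u)) = Lamplighter.dirac (x - ((k t : ℤ) - k s)) (a t u)) ∧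
      ∀ x v, F (Pi.mulSingle x (b s v)) = Lamplighter.dirac (x + ((k t : ℤ) - k s)) (b t v) := by
    intro t
    rcases eq_or_ne t s with rfl | hts
    · obtain ⟨F, h0, hinj, hF⟩ := LampWindow.exists_hom_same (Γ := Γ t) (r := r)
      exact ⟨F, h0, fun _ => hinj, by simp [hF], by simp [hF]⟩
    · have hd : (r : ℤ) < |(k t : ℤ) - k s| := by
        rcases lt_or_gt_of_ne hts with h | h
        · have := two_mul_lt_of_lt hk h
          rw [lt_abs]; omega
        · have := two_mul_lt_of_lt hk h
          rw [lt_abs]; omega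
      obtain ⟨F, h0, h1, h2⟩ :=
        LampWindow.exists_hom_other hAA hAB hBA hBB (a t) (b t) hd
      exact ⟨F, h0, fun h => absurd h hts, h1, h2⟩
  choose F h0 hinj hFA hFB using hF
  have conjA : ∀ t (x : Finset.Icc (-(r : ℤ)) r) u, lampHom (a t) (b t) (k t)
      (tau A B ^ ((x : ℤ) + k s) * inA A B u) =
      F t (Pi.mulSingle x (a s u)) * Lamplighter.shift ^ ((x : ℤ) + k s) := by
    intro t x u
    simp only [map_mul, map_zpow, lampHom_tau, lampHom_inA,
      Lamplighter.shift_zpow_mul_dirac, hFA]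
    congr 3; ring
  have conjB : ∀ t (x : Finset.Icc (-(r : ℤ)) r) v, lampHom (a t) (b t) (k t)
      (tau A B ^ ((x : ℤ) - k s) * inB A B v) =
      F t (Pi.mulSingle x (b s v)) * Lamplighter.shift ^ ((x : ℤ) - k s) := by
    intro t x v
    simp only [map_mul, map_zpow, lampHom_tau, lampHom_inB,
      Lamplighter.shift_zpow_mul_dirac, hFB]
    congr 3; ring
  -- the liftable configurations form a subgroup, which contains the generators of each factor
  have hw : ∀ f, ∃ y : FreeLampGroup A B, ∀ t, lampHom (a t) (b t) (k t) y = F t f := by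
    let M : Subgroup (LampWindow (Γ s) r) :=
      { carrier := {f | ∃ y : FreeLampGroup A B, ∀ t, lampHom (a t) (b t) (k t) y = F t f}
        one_mem' := ⟨1, fun t => by simp⟩
        mul_mem' := by
          rintro f g ⟨y, hy⟩ ⟨z, hz⟩
          exact ⟨y * z, fun t => by rw [map_mul, map_mul, hy, hz]⟩
        inv_mem' := by
          rintro f ⟨y, hy⟩
          exact ⟨y⁻¹, fun t => by
            rw [map_inv, ← hy]; exact MonoidHom.map_inv (lampHom (a t) (b t) (k t)) y⟩ }
    intro f
    refine (Subgroup.pi_mem_of_mulSingle_mem f fun x => ?_ : f ∈ M)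
    have : (⊤ : Subgroup (Γ s)) ≤ M.comap (MonoidHom.mulSingle (fun _ => Γ s) x) := by
      rw [← hgen s, Subgroup.closure_le]
      rintro _ (⟨u, rfl⟩ | ⟨v, rfl⟩)
      · refine ⟨tau A B ^ ((x : ℤ) + k s) * inA A B u * tau A B ^ (-((x : ℤ) + k s)), fun t => ?_⟩
        rw [map_mul, conjA, map_zpow, lampHom_tau, mul_assoc, ← zpow_add, add_neg_cancel,
          zpow_zero, mul_one]
        rfl
      · refine ⟨tau A B ^ ((x : ℤ) - k s) * inB A B v * tau A B ^ (-((x : ℤ) - k s)), fun t => ?_⟩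
        rw [map_mul, conjB, map_zpow, lampHom_tau, mul_assoc, ← zpow_add, add_neg_cancel,
          zpow_zero, mul_one]
        rfl
    exact this (Subgroup.mem_top (f x))
  choose w hw using hw
  refine ⟨w, fun f g h => hinj s rfl ?_, fun f => by rw [hw, h0], fun f x u => ?_, fun f x v => ?_⟩
  · simpa only [hw] using h
  · refine mk_eq_mk_iff_lampHom.2 fun t => ?_
    rw [map_mul, hw, map_mul (F t), map_zpow, lampHom_tau, mul_assoc, ← conjA, ← hw f t]
    simp only [map_mul, mul_assoc]
  · refine mk_eq_mk_iff_lampHom.2 fun t => ?_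
    rw [map_mul, hw, map_mul (F t), map_zpow, lampHom_tau, mul_assoc, ← conjB, ← hw f t]
    simp only [map_mul, mul_assoc]

end Lift

/-! ### Poincaré profiles and Cheeger constants -/

section Graphs

variable {V : Type*} (G : SimpleGraph V)

lemma gradAbs_nonneg (f : V → ℝ) (g : V) : 0 ≤ gradAbs G f g :=
  Real.sSup_nonneg (by rintro _ ⟨u, -, w, -, rfl⟩; exact abs_nonneg _)

lemma abs_sub_le_gradAbs [Finite V] (f : V → ℝ) {g u : V} (h : G.Adj g u) :
    |f u - f g| ≤ gradAbs G f g := by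
  refine le_csSup (Set.Finite.bddAbove ?_) ⟨u, Or.inr h, g, Or.inl rfl, rfl⟩
  refine (Set.finite_range fun x : V × V => |f x.1 - f x.2|).subset ?_
  rintro _ ⟨u, -, w, -, rfl⟩
  exact ⟨(u, w), rfl⟩

variable [Fintype V]

lemma ellNorm_nonneg (p : ℝ) (f : V → ℝ) : 0 ≤ ellNorm p f :=
  Real.rpow_nonneg (Finset.sum_nonneg fun _ _ => Real.rpow_nonneg (abs_nonneg _) _) _

lemma ellNorm_le_mul_ellNorm {p : ℝ} (hp : 1 ≤ p) {C : ℝ} (hC : 0 ≤ C) {f g : V → ℝ}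
    (h : ∑ v, |f v| ^ p ≤ C ^ p * ∑ v, |g v| ^ p) : ellNorm p f ≤ C * ellNorm p g := by
  have hp0 : 0 < p := by linarith
  have hnn : ∀ f : V → ℝ, 0 ≤ ∑ v, |f v| ^ p := fun f =>
    Finset.sum_nonneg fun _ _ => Real.rpow_nonneg (abs_nonneg _) _
  have := Real.rpow_le_rpow (hnn f) h (one_div_nonneg.2 hp0.le)
  rwa [Real.mul_rpow (Real.rpow_nonneg hC p) (hnn g), ← Real.rpow_mul hC,
    mul_one_div_cancel hp0.ne', Real.rpow_one] at this

lemma abs_le_ellNorm {p : ℝ} (hp : 1 ≤ p) (f : V → ℝ) (v : V) : |f v| ≤ ellNorm p f := by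
  have hp0 : 0 < p := by linarith
  have h := Finset.single_le_sum (f := fun v => |f v| ^ p)
    (fun v _ => Real.rpow_nonneg (abs_nonneg _) p) (Finset.mem_univ v)
  have := Real.rpow_le_rpow (Real.rpow_nonneg (abs_nonneg _) p) h (one_div_nonneg.2 hp0.le)
  rwa [← Real.rpow_mul (abs_nonneg _), mul_one_div_cancel hp0.ne', Real.rpow_one] at this

/-- The indicator function of a vertex is a test function for the `L^p`-Cheeger constant. -/
lemma exists_ellNorm_gradAbs_le {p : ℝ} (hp : 1 ≤ p) (hV : 2 ≤ Fintype.card V) :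
    ∃ f : V → ℝ, ellNorm p (fun v => f v - avg f) ≠ 0 ∧
      ellNorm p (gradAbs G f) / ellNorm p (fun v => f v - avg f) ≤ 2 * Fintype.card V := by
  classical
  have hp0 : 0 < p := by linarith
  have hV' : (2 : ℝ) ≤ Fintype.card V := by exact_mod_cast hV
  obtain ⟨v⟩ : Nonempty V := Fintype.card_pos_iff.1 (by omega)
  let f : V → ℝ := Pi.single v 1
  have hf : ∀ u, f u = 0 ∨ f u = 1 := fun u => by
    by_cases h : u = v
    · right; simp [f, h]
    · left; simp [f, h]
  have h1 : 1 / 2 ≤ ellNorm p (fun v => f v - avg f) := by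
    refine le_trans ?_ (abs_le_ellNorm hp (fun v => f v - avg f) v)
    have : avg f = 1 / Fintype.card V := by simp [avg, f]
    have h2 : 1 / (Fintype.card V : ℝ) ≤ 1 / 2 := by gcongr
    rw [this, show f v = 1 by simp [f], abs_of_nonneg] <;> linarith
  have hgrad : ∀ g, |gradAbs G f g| ≤ 1 := fun g => by
    rw [abs_of_nonneg (gradAbs_nonneg G f g)]
    refine Real.sSup_le ?_ zero_le_one
    rintro _ ⟨u, -, w, -, rfl⟩
    rcases hf u with h | h <;> rcases hf w with h' | h' <;> norm_num [h, h']
  have h2 : ellNorm p (gradAbs G f) ≤ Fintype.card V := by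
    have hsum : ∑ v, |gradAbs G f v| ^ p ≤ Fintype.card V := by
      simpa using Finset.sum_le_sum fun v (_ : v ∈ Finset.univ) =>
        Real.rpow_le_one (abs_nonneg _) (hgrad v) hp0.le
    calc ellNorm p (gradAbs G f) ≤ (Fintype.card V : ℝ) ^ (1 / p) :=
          Real.rpow_le_rpow (Finset.sum_nonneg fun _ _ => Real.rpow_nonneg (abs_nonneg _) _)
            hsum (one_div_nonneg.2 hp0.le)
      _ ≤ (Fintype.card V : ℝ) ^ (1 : ℝ) :=
          Real.rpow_le_rpow_of_exponent_le (by linarith) (by rwa [div_le_one hp0])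
      _ = _ := Real.rpow_one _
  refine ⟨f, by linarith, ?_⟩
  rw [div_le_iff₀ (by linarith)]
  nlinarith

lemma lpCheegerConst_nonneg (p : ℝ) : 0 ≤ lpCheegerConst G p :=
  Real.sInf_nonneg (by
    rintro _ ⟨f, -, rfl⟩
    exact div_nonneg (ellNorm_nonneg _ _) (ellNorm_nonneg _ _))

lemma lpCheegerConst_le {p : ℝ} (hp : 1 ≤ p) (hV : 2 ≤ Fintype.card V) :
    lpCheegerConst G p ≤ 2 * Fintype.card V := by
  obtain ⟨f, h0, hf⟩ := exists_ellNorm_gradAbs_le G hp hV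
  refine le_trans (csInf_le (s := {x : ℝ | ∃ f : V → ℝ, ellNorm p (fun v => f v - avg f) ≠ 0 ∧
    x = ellNorm p (gradAbs G f) / ellNorm p (fun v => f v - avg f)}) ⟨0, ?_⟩ ⟨f, h0, rfl⟩) hf
  rintro _ ⟨f, -, rfl⟩
  exact div_nonneg (ellNorm_nonneg _ _) (ellNorm_nonneg _ _)

end Graphs

section Profile

variable {W : Type*} (G : SimpleGraph W)

lemma poincareProfile_nonneg (p : ℝ) (n : ℕ) : 0 ≤ poincareProfile G p n :=
  Real.sSup_nonneg (by
    rintro _ ⟨H, _, -, -, rfl⟩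
    exact mul_nonneg (Nat.cast_nonneg _) (lpCheegerConst_nonneg _ p))

lemma bddAbove_poincareProfile {p : ℝ} (hp : 1 ≤ p) (n : ℕ) :
    BddAbove {x : ℝ | ∃ (H : G.Subgraph) (_ : Fintype H.verts), 2 ≤ Fintype.card H.verts ∧
      Fintype.card H.verts ≤ n ∧ x = (Fintype.card H.verts : ℝ) * lpCheegerConst H.coe p} := by
  refine ⟨n * (2 * n), ?_⟩
  rintro _ ⟨H, _, h2, hn, rfl⟩
  have hn' : (Fintype.card H.verts : ℝ) ≤ n := by exact_mod_cast hn
  have h1 := lpCheegerConst_le H.coe hp h2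
  exact mul_le_mul hn' (h1.trans (by linarith)) (lpCheegerConst_nonneg _ p) (Nat.cast_nonneg n)

/-- A lower bound for the Poincaré profile from an `ℓ^p`-Poincaré inequality on a finite set of
vertices, with the subgraph induced on it. -/
lemma le_poincareProfile {V : Type*} [Fintype V] {p : ℝ} (hp : 1 ≤ p) {n : ℕ} {e : V → W}
    (he : Function.Injective e) (h2 : 2 ≤ Fintype.card V) (hn : Fintype.card V ≤ n) {C : ℝ}
    (hC : 0 < C)
    (hP : ∀ f D : V → ℝ, (∀ v, 0 ≤ D v) → (∀ v w, G.Adj (e v) (e w) → |f w - f v| ≤ D v) →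
      ∑ v, |f v - avg f| ^ p ≤ C ^ p * ∑ v, D v ^ p) :
    Fintype.card V / C ≤ poincareProfile G p n := by
  classical
  let H : G.Subgraph := (⊤ : G.Subgraph).induce (Set.range e)
  let E : V ≃ H.verts := Equiv.ofInjective e he
  let _ : Fintype H.verts := Fintype.ofEquiv V E
  have hcard : Fintype.card H.verts = Fintype.card V := (Fintype.card_congr E).symm
  have hh : 1 / C ≤ lpCheegerConst H.coe p := by
    obtain ⟨f₀, h0, -⟩ := exists_ellNorm_gradAbs_le H.coe hp (hcard.symm ▸ h2)
    refine le_csInf ⟨_, f₀, h0, rfl⟩ ?_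
    rintro _ ⟨f, hf, rfl⟩
    have hpos := (ellNorm_nonneg p _).lt_of_ne hf.symm
    rw [div_le_div_iff₀ hC hpos, one_mul, mul_comm]
    refine ellNorm_le_mul_ellNorm hp hC.le ?_
    have havg : avg (f ∘ E) = avg f := by
      rw [avg, avg, hcard]
      congr 1
      exact E.sum_comp f
    have := hP (f ∘ E) (gradAbs H.coe f ∘ E) (fun v => gradAbs_nonneg _ _ _) (fun v w hvw =>
      abs_sub_le_gradAbs H.coe f (g := E v) (u := E w)
        ⟨⟨v, rfl⟩, ⟨w, rfl⟩, hvw⟩)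
    rw [havg] at this
    rw [← E.sum_comp, ← E.sum_comp fun v => |gradAbs H.coe f v| ^ p]
    simpa only [abs_of_nonneg (gradAbs_nonneg _ _ _), Function.comp] using this
  refine le_csSup_of_le (bddAbove_poincareProfile G hp n)
    ⟨H, inferInstance, hcard.symm ▸ h2, hcard.symm ▸ hn, rfl⟩ ?_
  rw [hcard, div_eq_mul_one_div]
  exact mul_le_mul_of_nonneg_left hh (Nat.cast_nonneg _)

end Profile

section FactorGraph

variable {A B Γ : Type*} [Group A] [Group B] [Group Γ] (a : A →* Γ) (b : B →* Γ)

lemma factorCayleyGraph_adj {g x : Γ} :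
    (factorCayleyGraph a b).Adj g x ↔ g ≠ x ∧ g⁻¹ * x ∈ Set.range a ∪ Set.range b := by
  have hinv : ∀ y, y ∈ Set.range a ∪ Set.range b → y⁻¹ ∈ Set.range a ∪ Set.range b := by
    rintro _ (⟨u, rfl⟩ | ⟨v, rfl⟩)
    · exact Or.inl ⟨u⁻¹, map_inv a u⟩
    · exact Or.inr ⟨v⁻¹, map_inv b v⟩
  rw [factorCayleyGraph, SimpleGraph.mulCayley_adj']
  refine and_congr_right fun _ => ⟨?_, fun h => ⟨_, h, Or.inl (mul_inv_cancel_left g x)⟩⟩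
  rintro ⟨y, hy, rfl | rfl⟩
  · rwa [inv_mul_cancel_left]
  · rw [mul_inv_rev, inv_mul_cancel_right]
    exact hinv y hy

lemma cheegerConst_nonneg {V : Type*} [Finite V] (G : SimpleGraph V) : 0 ≤ cheegerConst G :=
  Real.sInf_nonneg (by rintro _ ⟨X, -, -, rfl⟩; positivity)

lemma cheegerConst_le {V : Type*} [Finite V] (G : SimpleGraph V) {X : Set V} (hX : X.Nonempty)
    (hX2 : 2 * X.ncard ≤ Nat.card V) :
    cheegerConst G ≤ (outerBoundary G X).ncard / X.ncard := by
  refine csInf_le ⟨0, ?_⟩ ⟨X, hX, hX2, rfl⟩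
  rintro _ ⟨X, -, -, rfl⟩
  positivity

lemma cheegerConst_factorCayleyGraph_le_degree [Finite Γ] [Nontrivial Γ] :
    cheegerConst (factorCayleyGraph a b) ≤ factorCayleyDegree a b := by
  have h := cheegerConst_le (factorCayleyGraph a b) (Set.singleton_nonempty 1)
    (by rw [Set.ncard_singleton]; exact Finite.one_lt_card)
  rw [Set.ncard_singleton, Nat.cast_one, div_one] at h
  refine h.trans ?_
  rw [factorCayleyDegree]
  exact_mod_cast Set.ncard_le_ncard (fun v hv => by
    obtain ⟨-, u, rfl, hu⟩ := hv
    exact hu) (Set.toFinite _)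

lemma isoperimetric_factorCayleyGraph [Fintype Γ] :
    Isoperimetric ((factorCayleyGraph a b).neighborSet 1).toFinite.toFinset
      (cheegerConst (factorCayleyGraph a b)) := by
  classical
  intro X hX hX2
  have h := cheegerConst_le (factorCayleyGraph a b) (X := X) hX
    (by rwa [Set.ncard_coe_finset, Nat.card_eq_fintype_card])
  rw [Set.ncard_coe_finset, le_div_iff₀ (by exact_mod_cast hX.card_pos)] at h
  refine h.trans ?_
  rw [Set.ncard_eq_toFinset_card', Finset.card_eq_sum_ones, Nat.cast_sum]
  refine (Finset.sum_le_sum fun v hv => ?_).trans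
    (Finset.sum_le_sum_of_subset_of_nonneg (Finset.subset_univ _) fun v _ _ =>
      Finset.sum_nonneg fun s _ => abs_nonneg _)
  rw [Set.mem_toFinset] at hv
  obtain ⟨hvX, u, huX, huv⟩ := hv
  have hs : v⁻¹ * u ∈ ((factorCayleyGraph a b).neighborSet 1).toFinite.toFinset := by
    have h' := (factorCayleyGraph_adj a b).1 huv.symm
    rw [Set.Finite.mem_toFinset, SimpleGraph.mem_neighborSet, factorCayleyGraph_adj]
    refine ⟨fun h1 => h'.1 ?_, by simpa using h'.2⟩
    rwa [eq_comm, inv_mul_eq_one] at h1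
  refine le_trans ?_ (Finset.single_le_sum (fun s _ => abs_nonneg _) hs)
  have hvX' : v ∉ X := hvX
  have huX' : u ∈ X := huX
  simp [hvX', huX']

end FactorGraph

/-! ### The subgraph of the diagonal product and its profile -/

section Subgraph

variable {A B : Type*} [Group A] [Group B] {Γ : ℕ → Type*} [∀ s, Group (Γ s)]
  {a : ∀ s, A →* Γ s} {b : ∀ s, B →* Γ s} {k : ℕ → ℕ}

open FreeLampGroup in
/-- A window of lamps of `Γ_s` together with a segment of cursor positions, long enough for each
lamp of the window to be reached by both `A` and `B`, embeds in the Cayley graph of the diagonal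
product. -/
lemma exists_lampCursor_embedding [Finite A] [Finite B] (ha : ∀ s, Function.Injective (a s))
    (hb : ∀ s, Function.Injective (b s))
    (hgen : ∀ s, Subgroup.closure (((a s).range : Set (Γ s)) ∪ ((b s).range : Set (Γ s))) = ⊤)
    (hquot : ∀ s, Nonempty
      ((Γ s ⧸ Subgroup.normalClosure
        ((⁅(a s).range, (b s).range⁆ : Subgroup (Γ s)) : Set (Γ s))) ≃*
        ((a s).range × (b s).range)))
    (hk : ∀ s, 2 * k s < k (s + 1)) (s r : ℕ) (hr : 2 * r ≤ k s) :
    ∃ e : LampWindow (Γ s) r × Fin (2 * k s + 2 * r + 1) → LampDiagonalProduct a b k,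
      Function.Injective e ∧
      (∀ φ (i j : Fin (2 * k s + 2 * r + 1)), (j : ℕ) = i + 1 →
        (lampDiagonalGraph a b k).Adj (e (φ, i)) (e (φ, j))) ∧
      ∀ (x : Finset.Icc (-(r : ℤ)) r) (g : Γ s), g ≠ 1 →
        g ∈ Set.range (a s) ∪ Set.range (b s) →
        ∃ j, ∀ φ, (lampDiagonalGraph a b k).Adj (e (φ, j))
          (e (φ * (Pi.mulSingle x g : LampWindow (Γ s) r), j)) := by
  obtain ⟨w, hinj, hcur, hwA, hwB⟩ := exists_lift_lampWindow ha hb hgen hquot hk s r hr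
  -- the cursor positions are `-(k_s + r), …, k_s + r`, numbered from `0`
  let pos : Fin (2 * k s + 2 * r + 1) → ℤ := fun i => (i : ℤ) - (k s + r)
  let e : LampWindow (Γ s) r × Fin (2 * k s + 2 * r + 1) → LampDiagonalProduct a b k :=
    fun v => ((w v.1 * tau A B ^ pos v.2 : FreeLampGroup A B) : LampDiagonalProduct a b k)
  have he : Function.Injective e := by
    rintro ⟨φ, i⟩ ⟨ψ, j⟩ h
    have h1 := mk_eq_mk_iff_lampHom.1 h s
    rw [map_mul, map_mul, map_zpow, map_zpow, lampHom_tau] at h1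
    have h2 := congrArg Lamplighter.cursor h1
    simp only [Lamplighter.mul_cursor, hcur, Lamplighter.shift_zpow_cursor, zero_add] at h2
    have hij : i = j := by ext; simp only [pos] at h2; omega
    subst hij
    exact congrArg (·, i) (hinj (mul_right_cancel h1))
  have hadj : ∀ v v' (y : FreeLampGroup A B), v ≠ v' →
      (y : LampDiagonalProduct a b k) ∈ lampGenerators a b k →
      e v' = ((w v.1 * tau A B ^ pos v.2 * y : FreeLampGroup A B) :
        LampDiagonalProduct a b k) →
      (lampDiagonalGraph a b k).Adj (e v) (e v') := by
    intro v v' y hne hy h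
    exact (SimpleGraph.mulCayley_adj' _ _ _).2 ⟨he.ne hne, y, hy, Or.inl h.symm⟩
  have hne : ∀ φ (x : Finset.Icc (-(r : ℤ)) r) (g : Γ s) (j : Fin (2 * k s + 2 * r + 1)), g ≠ 1 →
      (φ, j) ≠ (φ * (Pi.mulSingle x g : LampWindow (Γ s) r), j) := by
    intro φ x g j hg h
    have h1 := congrArg Prod.fst h
    rw [eq_comm, mul_eq_left, Pi.mulSingle_eq_one_iff] at h1
    exact hg h1
  refine ⟨e, he, fun φ i j hij => ?_, ?_⟩
  · refine hadj _ _ (tau A B) (fun h => ?_)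
      ⟨_, Or.inr (Set.mem_insert _ _), rfl⟩ (mk_eq_mk_iff_lampHom.2 fun t => ?_)
    · have := congrArg Prod.snd h
      simp only at this
      rw [this] at hij
      omega
    · have hp : pos j = pos i + 1 := by simp only [pos, hij]; push_cast; ring
      simp only [map_mul, map_zpow, lampHom_tau, hp, zpow_add_one, mul_assoc]
  · rintro x _ hg (⟨u, rfl⟩ | ⟨v, rfl⟩)
    · have hx := Finset.mem_Icc.1 x.2
      refine ⟨⟨((x : ℤ) + 2 * k s + r).toNat, by omega⟩, fun φ => ?_⟩
      refine hadj _ _ (inA A B u) (hne _ _ _ _ hg)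
        ⟨_, Or.inl (Or.inl (Set.mem_range_self u)), rfl⟩ ?_
      have hp : pos ⟨((x : ℤ) + 2 * k s + r).toNat, by omega⟩ = x + k s := by
        simp only [pos]; omega
      simp only [e, hp]
      exact hwA φ x u
    · have hx := Finset.mem_Icc.1 x.2
      refine ⟨⟨((x : ℤ) + r).toNat, by omega⟩, fun φ => ?_⟩
      refine hadj _ _ (inB A B v) (hne _ _ _ _ hg)
        ⟨_, Or.inl (Or.inr (Set.mem_range_self v)), rfl⟩ ?_
      have hp : pos ⟨((x : ℤ) + r).toNat, by omega⟩ = x - k s := by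
        simp only [pos]; omega
      simp only [e, hp]
      exact hwB φ x v

end Subgraph

theorem mainTheorem10 {A B : Type*} [Group A] [Group B] [Finite A] [Finite B]
    [Nontrivial A] [Nontrivial B] {Γ : ℕ → Type*} [∀ s, Group (Γ s)]
    (a : ∀ s, A →* Γ s) (b : ∀ s, B →* Γ s) (k : ℕ → ℕ)
    (ha : ∀ s, Function.Injective (a s)) (hb : ∀ s, Function.Injective (b s))
    (hgen : ∀ s, Subgroup.closure (((a s).range : Set (Γ s)) ∪ ((b s).range : Set (Γ s))) = ⊤)
    (hquot : ∀ s, Nonempty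
      ((Γ s ⧸ Subgroup.normalClosure
        ((⁅(a s).range, (b s).range⁆ : Subgroup (Γ s)) : Set (Γ s))) ≃*
        ((a s).range × (b s).range)))
    (hk0 : k 0 = 0) (hk : ∀ s, 2 * k s < k (s + 1))
    (p : ℝ) (hp : 1 ≤ p) (s : ℕ) [Finite (Γ s)] (r : ℕ) (hr : 2 * r ≤ k s) :
    (4 : ℝ) ^ (-p) *
        (cheegerConst (factorCayleyGraph (a s) (b s)) ^ 2 /
          (1536 * (factorCayleyDegree (a s) (b s) : ℝ) ^ 2)) *
        ((Nat.card (Γ s) : ℝ) ^ (2 * r + 1) / (2 * (r : ℝ) + 1)) ≤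
      poincareProfile (lampDiagonalGraph a b k) p
        ((2 * k s + 2 * r + 1) * Nat.card (Γ s) ^ (2 * r + 1)) := by
  classical
  let _ : Fintype (Γ s) := Fintype.ofFinite (Γ s)
  have : Nontrivial (Γ s) := (ha s).nontrivial
  set h := cheegerConst (factorCayleyGraph (a s) (b s)) with hh
  set d := factorCayleyDegree (a s) (b s) with hd
  -- the Poincaré constant has `h` in its denominator; for `h = 0` the bound is trivial
  rcases (cheegerConst_nonneg (factorCayleyGraph (a s) (b s))).eq_or_lt with h0 | hpos
  · rw [hh, ← h0]
    simpa using poincareProfile_nonneg _ p _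
  set S := ((factorCayleyGraph (a s) (b s)).neighborSet 1).toFinite.toFinset with hS
  have hScard : S.card = d := (Set.ncard_eq_toFinset_card _ _).symm
  have hhd : h ≤ d := cheegerConst_factorCayleyGraph_le_degree (a s) (b s)
  have hd0 : (0 : ℝ) < d := hpos.trans_le hhd
  have hSne : S.Nonempty := Finset.card_pos.1 (by rw [hScard]; exact_mod_cast hd0)
  have hmemS : ∀ g ∈ S, g ≠ 1 ∧ g ∈ Set.range (a s) ∪ Set.range (b s) := by
    intro g hg
    rw [hS, Set.Finite.mem_toFinset, SimpleGraph.mem_neighborSet, factorCayleyGraph_adj] at hg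
    exact ⟨hg.1.symm, by simpa using hg.2⟩
  obtain ⟨e, he, hmove, hlamp⟩ := exists_lampCursor_embedding ha hb hgen hquot hk s r hr
  have hι : Fintype.card (Finset.Icc (-(r : ℤ)) r) = 2 * r + 1 := by
    rw [Fintype.card_coe, Int.card_Icc]; omega
  have : Nonempty (Finset.Icc (-(r : ℤ)) r) := Fintype.card_pos_iff.1 (by omega)
  have hV : Fintype.card (LampWindow (Γ s) r × Fin (2 * k s + 2 * r + 1)) =
      (2 * k s + 2 * r + 1) * Nat.card (Γ s) ^ (2 * r + 1) := by
    rw [Fintype.card_prod, Fintype.card_fun, hι, Fintype.card_fin, Nat.card_eq_fintype_card,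
      mul_comm]
  have hV2 : 2 ≤ Fintype.card (LampWindow (Γ s) r × Fin (2 * k s + 2 * r + 1)) := by
    have hN : 2 ≤ Nat.card (Γ s) := Finite.one_lt_card
    rw [hV]
    calc 2 ≤ Nat.card (Γ s) ^ 1 := by rwa [pow_one]
      _ ≤ Nat.card (Γ s) ^ (2 * r + 1) := Nat.pow_le_pow_right (by omega) (by omega)
      _ ≤ _ := Nat.le_mul_of_pos_left _ (by omega)
  have hp0 : 0 < p := by linarith
  have hmain := le_poincareProfile (lampDiagonalGraph a b k) hp he hV2 hV.le
    (C := 48 * p * S.card * Fintype.card (Finset.Icc (-(r : ℤ)) r) *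
      (2 * k s + 2 * r + 1 : ℕ) / h)
    (by rw [hScard, hι]; positivity) (fun f D hD hfD =>
      (isoperimetric_factorCayleyGraph (a s) (b s)).lampCursor_poincare hpos hSne
        (by rw [hScard]; exact hhd) hp (by omega) f D hD
        (fun φ i j hij => hfD _ _ (hmove φ i j hij))
        (fun x g hg => by
          obtain ⟨j, hj⟩ := hlamp x g (hmemS g hg).1 (hmemS g hg).2
          exact ⟨j, fun φ => hfD _ _ (hj φ)⟩))
  refine le_trans ?_ hmain
  rw [hV, hScard, hι]
  have h4 : p ≤ (4 : ℝ) ^ p := by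
    have := one_add_mul_self_le_rpow_one_add (s := 3) (by norm_num) hp
    norm_num at this
    linarith
  have h4' : (0 : ℝ) < 4 ^ p := by positivity
  have hN : (0 : ℝ) < Nat.card (Γ s) := by exact_mod_cast Nat.card_pos
  push_cast
  rw [Real.rpow_neg (by norm_num)]
  calc ((4 : ℝ) ^ p)⁻¹ * (h ^ 2 / (1536 * d ^ 2)) *
        ((Nat.card (Γ s) : ℝ) ^ (2 * r + 1) / (2 * r + 1))
      = (h / (1536 * 4 ^ p * d)) * (h / d) *
          ((Nat.card (Γ s) : ℝ) ^ (2 * r + 1) / (2 * r + 1)) := by field_simp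
    _ ≤ (h / (48 * p * d)) * 1 * ((Nat.card (Γ s) : ℝ) ^ (2 * r + 1) / (2 * r + 1)) := by
        have h5 : h / d ≤ 1 := (div_le_one hd0).2 hhd
        gcongr
        norm_num
    _ = _ := by field_simp
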